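/- Let $\beta,\gamma,\epsilon\in\mathbb R$ and $\kappa=\frac14\,[8(1+\gamma)-4\beta+3\epsilon]$. For $m>0$ (the mass parameter $GM/c^2$, proportional to $G$) consider the static, spherically symmetric metric in isotropic coordinates $$ds^2=\mathcal A(r)\,(dx^0)^2-\frac1{\mathcal B(r)}\,\delta_{ij}\,dx^i dx^j,\qquad r=|\boldsymbol x|,$$ where, in the exterior region $r>r_h=\rho\,m$ ($\rho>0$ fixed), $\mathcal A$ and $\mathcal B$ are positive and $\mathcal A$, $1/\mathcal B$ are sums of power series in $m/r$ with coefficients independent of $m$: $$\mathcal A(r)=1-\frac{2m}{r}+2\beta\frac{m^2}{r^2}+\cdots,\qquad \frac1{\mathcal B(r)}=1+2\gamma\frac{m}{r}+\frac32\epsilon\frac{m^2}{r^2}+\cdots .$$ Let $\boldsymbol N_e$ be a unit vector and $\boldsymbol x_B=r_B\boldsymbol n_B$ a point, with $r_B>0$, $|\boldsymbol n_B|=1$ and $\boldsymbol N_e\times\boldsymbol n_B\neq 0$. Let $\Gamma_s(\boldsymbol N_e,\boldsymbol x_B)$ be a quasi-Minkowskian light ray emitted at infinity in the direction $\boldsymbol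 N_e$ and received at $\boldsymbol x_B$: for every sufficiently small $m$, a null geodesic with affine parameter $\sigma\in(-\infty,\sigma_B]$, lying in $r>r_h$, of the form $$x^0=x^0_B+\sigma-\sigma_B+\sum_{n\ge1}m^nX^0_{(n)}(\sigma),\qquad \boldsymbol x=\boldsymbol x_B+(\sigma-\sigma_B)\boldsymbol N_e+\sum_{n\ge1}m^n\boldsymbol X_{(n)}(\sigma),$$ with $X^0_{(n)}(\sigma_B)=0$, $\boldsymbol X_{(n)}(\sigma_B)=0$, whose coordinate velocity $d\boldsymbol x/dx^0$ tends to $\boldsymbol N_e$ as $\sigma\to-\infty$. Put $r_c=r_B|\boldsymbol N_e\times\boldsymbol n_B|$ and $$\boldsymbol P_e=\frac{\boldsymbol N_e\times\boldsymbol n_B}{|\boldsymbol N_e\times\boldsymbol n_B|}\times\boldsymbol N_e .$$ Then the direction triple $\widehat{\underline{\boldsymbol l}}_{\,r}(\boldsymbol N_e,\boldsymbol x_B)=(l_i/l_0)_{i=1,2,3}$ at $\boldsymbol x_B$, where $l_\alpha=g_{\alpha\beta}\,dx^\beta/d\sigma$, satisfies $$\begin{aligned}\widehat{\underline{\boldsymbol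 l}}_{\,r}=&-\boldsymbol N_e-\frac{m}{r_c}\Big\{(1+\gamma)|\boldsymbol N_e\times\boldsymbol n_B|+\frac{m}{r_c}\Big[\kappa|\boldsymbol N_e\times\boldsymbol n_B|^2-(1+\gamma)^2(1+\boldsymbol N_e\cdot\boldsymbol n_B)\Big]\Big\}\boldsymbol N_e\\&+\frac{m}{r_c}\Big\{(1+\gamma)(1+\boldsymbol N_e\cdot\boldsymbol n_B)+\frac{m}{r_c}\Big\{\kappa\Big[\pi-\arccos(\boldsymbol N_e\cdot\boldsymbol n_B)+|\boldsymbol N_e\times\boldsymbol n_B|\,\boldsymbol N_e\cdot\boldsymbol n_B\Big]-(1+\gamma)^2\frac{(1+\boldsymbol N_e\cdot\boldsymbol n_B)^2}{|\boldsymbol N_e\times\boldsymbol n_B|}\Big\}\Big\}\boldsymbol P_e+O\!\left(\frac{m^3}{r_c^3}\right)\end{aligned}$$ as $m\to0^+$: there is a constant $C$, depending only on the two potentials (as functions of $m/r$), $\boldsymbol N_e$ and $\boldsymbol n_B$, such that the Euclidean norm of the remainder is at most $C\,(m/r_c)^3$ for all sufficiently small $m>0$. -/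

import Mathlib

open Filter Topology

noncomputable section

/-- Ordered triples, as vectors of the ordinary Euclidean space. -/
abbrev Triple : Type := EuclideanSpace ℝ (Fin 3)

/-- The usual cross product of triples. -/
def Triple.cross (v w : Triple) : Triple :=
  WithLp.toLp 2 (crossProduct (WithLp.ofLp v) (WithLp.ofLp w))

/-- Coordinate quadruples `(x⁰, x¹, x², x³)`. -/
abbrev Event : Type := Fin 4 → ℝ

/-- The spatial triple `(x¹, x², x³)`; index `i : Fin 3` stands for the Latin index `i + 1`. -/
def Event.space (z : Event) : Triple := WithLp.toLp 2 (fun i : Fin 3 => z i.succ)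

section Geodesics

variable (g : Event → Matrix (Fin 4) (Fin 4) ℝ)

/-- The tangent vector `dx^α/dσ` of a path parametrized by `σ ≤ σB` (one-sided at `σB`). -/
def tangent (σB : ℝ) (z : ℝ → Event) (σ : ℝ) : Event := derivWithin z (Set.Iic σB) σ

/-- Its covariant components `l_α = g_{αβ} dx^β/dσ`. -/
def covTangent (σB : ℝ) (z : ℝ → Event) (σ : ℝ) : Event :=
  fun α => ∑ β, g (z σ) α β * tangent σB z σ β

/-- The partial derivative `∂g_{μν}/∂x^α` at an event. -/
def metricPartial (z : Event) (α μ ν : Fin 4) : ℝ :=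
  fderiv ℝ (fun y => g y μ ν) z (Pi.single α 1)

/-- `z`, restricted to `σ ≤ σB`, is an affinely parametrized null geodesic of the metric `g`:
it is differentiable, its tangent vector is nonzero and null, and it satisfies the
Euler-Lagrange equations `dl_α/dσ = ½ (∂_α g_{μν}) (dx^μ/dσ) (dx^ν/dσ)`. -/
structure IsNullGeodesic (σB : ℝ) (z : ℝ → Event) : Prop where
  differentiable : DifferentiableOn ℝ z (Set.Iic σB)
  tangent_ne_zero : ∀ σ ≤ σB, tangent σB z σ ≠ 0
  null : ∀ σ ≤ σB, ∑ μ, ∑ ν, g (z σ) μ ν * tangent σB z σ μ * tangent σB z σ ν = 0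
  geodesic : ∀ σ ≤ σB, ∀ α : Fin 4,
    HasDerivWithinAt (fun τ => covTangent g σB z τ α)
      ((1 / 2) * ∑ μ, ∑ ν,
        metricPartial g (z σ) α μ ν * tangent σB z σ μ * tangent σB z σ ν)
      (Set.Iic σB) σ

/-- The direction triple `(l_i / l_0)` at the point of parameter `σ`. -/
def directionTriple (σB : ℝ) (z : ℝ → Event) (σ : ℝ) : Triple :=
  WithLp.toLp 2 (fun i : Fin 3 => covTangent g σB z σ i.succ / covTangent g σB z σ 0)

end Geodesics

/-- The coordinate velocity `dx^i/dx⁰` along a path. -/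
def coordVelocity (σB : ℝ) (z : ℝ → Event) (σ : ℝ) : Triple :=
  WithLp.toLp 2 (fun i : Fin 3 => tangent σB z σ i.succ / tangent σB z σ 0)

/-- The potentials `𝒜(r) = A (m / r)` and `ℬ(r) = B (m / r)` of a static, spherically symmetric
metric in isotropic coordinates. Both are positive, and `𝒜` and `1 / ℬ` are the sums of power
series in `m / r`, in the exterior region `r > r_h = ρ m`; the coefficients do not depend on `m`
and those of order at most two are given by the parameters `β`, `γ`, `ε`. -/
structure Potentials (β γ ε : ℝ) where
  A : ℝ → ℝ
  B : ℝ → ℝ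
  ρ : ℝ
  ρ_pos : 0 < ρ
  A_pos : ∀ u, 0 < u → u < 1 / ρ → 0 < A u
  B_pos : ∀ u, 0 < u → u < 1 / ρ → 0 < B u
  aCoeff : ℕ → ℝ
  bCoeff : ℕ → ℝ
  hasSum_A : ∀ u, 0 < u → u < 1 / ρ → HasSum (fun n => aCoeff n * u ^ n) (A u)
  hasSum_B : ∀ u, 0 < u → u < 1 / ρ → HasSum (fun n => bCoeff n * u ^ n) (1 / B u)
  aCoeff_zero : aCoeff 0 = 1
  aCoeff_one : aCoeff 1 = -2
  aCoeff_two : aCoeff 2 = 2 * β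
  bCoeff_zero : bCoeff 0 = 1
  bCoeff_one : bCoeff 1 = 2 * γ
  bCoeff_two : bCoeff 2 = 3 / 2 * ε

variable {β γ ε : ℝ}

/-- The metric `ds² = 𝒜(r) (dx⁰)² - ℬ(r)⁻¹ δ_{ij} dx^i dx^j`, where `r = |x|`. -/
def Potentials.metric (P : Potentials β γ ε) (m : ℝ) (z : Event) : Matrix (Fin 4) (Fin 4) ℝ :=
  Matrix.diagonal (Fin.cons (P.A (m / ‖z.space‖)) (fun _ : Fin 3 => -(1 / P.B (m / ‖z.space‖))))

/-- `Γ m`, `0 < m < m₀`, is a quasi-Minkowskian light ray emitted at infinity in the direction `Ne`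
and received at the spatial point `xB` and the time `x0B`, at the value `σB` of an affine parameter
`σ ≤ σB`: for each `m` a null geodesic lying in `r > r_h`, given by a perturbation series in powers
of `m` (which is proportional to `G`) of the straight line
`x⁰ = x0B + σ - σB`, `x = xB + (σ - σB) Ne`, with corrections vanishing at `σB`,
and having `Ne` as its direction of emission at infinity (that is, for `σ → -∞`). -/
structure IsQuasiMinkowskianFromInfinity (P : Potentials β γ ε) (Ne xB : Triple) (x0B σB m₀ : ℝ)
    (Γ : ℝ → ℝ → Event) : Prop where
  nullGeodesic : ∀ m, 0 < m → m < m₀ → IsNullGeodesic (P.metric m) σB (Γ m)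
  exterior : ∀ m, 0 < m → m < m₀ → ∀ σ ≤ σB, P.ρ * m < ‖(Γ m σ).space‖
  expansion : ∃ (X0 : ℕ → ℝ → ℝ) (X : ℕ → ℝ → Triple),
    (∀ n, X0 n σB = 0) ∧ (∀ n, X n σB = 0) ∧
    ∀ m, 0 < m → m < m₀ → ∀ σ ≤ σB,
      HasSum (fun n => m ^ (n + 1) * X0 n σ) (Γ m σ 0 - (x0B + (σ - σB))) ∧
      HasSum (fun n => m ^ (n + 1) • X n σ) ((Γ m σ).space - (xB + (σ - σB) • Ne))
  emission : ∀ m, 0 < m → m < m₀ → Tendsto (coordVelocity σB (Γ m)) atBot (𝓝 Ne)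

/-- The parameter `κ`. -/
def kappa (β γ ε : ℝ) : ℝ := (1 / 4) * (8 * (1 + γ) - 4 * β + 3 * ε)

/-- The unit triple `P_e` orthogonal to `Ne`. -/
def Pe (Ne nB : Triple) : Triple :=
  Triple.cross (‖Triple.cross Ne nB‖⁻¹ • Triple.cross Ne nB) Ne

end

/-! The metric is static, so `l_0` is conserved; dividing the spatial geodesic equations by it gives
equations for `p = -(l_i/l_0)` alone. The null condition reads `‖p‖² = N(m/r)`, where `N = 1/(𝒜ℬ)`
is the squared refractive index, and the force on `p` is central with strength governed by `N'/2`.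
Expanding the potentials, `N(u) = 1 + 2(1+γ)u + 2κu² + O(u³)`, so only `1+γ` and `κ` can enter at
second order.

A central force conserves angular momentum. Since the ray comes from infinity along `Ne`, the motion
stays in the plane of `Ne` and `nB` (`planar_of_central`). Let `b > 0` be the angular momentum, `e =
m/b`, `θ` the polar angle counted from the incoming direction, and `P`, `Q` the components of `p`
along `Ne` and `Pe`. With `G = N'/2` one has exactly `dP = e G cos θ dθ`, `dQ = -e G sin θ dθ` and
`b/r = P sin θ + Q cos θ`. A first, crude integration gives `b/r = sin θ + O(e)`, hence `G = (1+γ) +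
2κ e sin θ + O(e²)`; a second one, from `θ = 0` to `θ = π - arccos c`, gives `P` and `Q` up to
`O(e³)` (`abs_direction_sub_le`). The angle itself, `π - arccos c`, comes from integrating `sin² θ`.

The result is in powers of `m/b`, while the statement uses `m/r_c`. The two are related through the
direction at reception, `b = r_B (s P - c Q)`; inverting this relation produces the `(1+γ)²` terms
(`exists_bound_of_impact_parameter`).

One thing must be excluded: a ray reaching the same point after strong deflection. The formal series
gives convergence of positions for each fixed `σ` but not of tangents, so `p(σB) → Ne` is recovered
from a short chord ending at `x_B`, along which the ray is straight up to `O(m)`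
(`eventually_direction_near`). -/

noncomputable section

variable {β γ ε : ℝ}

/-! ### Expansions of the potentials and of the refractive index -/

/-- The sum of a power series on `(0, R)` extends to an analytic function on `(-R, R)`. -/
theorem exists_analyticAt_of_hasSum_pow {c : ℕ → ℝ} {R : ℝ} {f : ℝ → ℝ} (hR : 0 < R)
    (h : ∀ u, 0 < u → u < R → HasSum (fun n => c n * u ^ n) (f u)) :
    ∃ F : ℝ → ℝ, (∀ u, |u| < R → AnalyticAt ℝ F u) ∧ (∀ u, 0 < u → u < R → F u = f u) ∧
      F 0 = c 0 := by
  set p := FormalMultilinearSeries.ofScalars ℝ c with hp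
  have hsum : ∀ x, p.sum x = ∑' n, c n * x ^ n := fun x => by
    have := congrFun (FormalMultilinearSeries.ofScalarsSum_eq_tsum (E := ℝ) c) x
    simpa [FormalMultilinearSeries.ofScalarsSum, smul_eq_mul] using this
  have hrad : ∀ r : ℝ, 0 < r → r < R → ENNReal.ofReal r ≤ p.radius := fun r hr hrR => by
    have hs := (h r hr hrR).summable.norm
    refine p.le_radius_of_summable_norm (r := r.toNNReal) (hs.congr fun n => ?_)
    rw [hp, FormalMultilinearSeries.ofScalars_norm, norm_mul, norm_pow, Real.coe_toNNReal _ hr.le,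
      Real.norm_of_nonneg hr.le]
  have hpos : 0 < p.radius := by
    refine lt_of_lt_of_le ?_ (hrad (R / 2) (by linarith) (by linarith))
    rw [ENNReal.ofReal_pos]; linarith
  refine ⟨p.sum, fun u hu => ?_, fun u h0 hu => ?_, ?_⟩
  · refine (p.hasFPowerSeriesOnBall hpos).analyticAt_of_mem ?_
    obtain ⟨r, hur, hrR⟩ := exists_between hu
    have hr0 : 0 < r := lt_of_le_of_lt (abs_nonneg u) hur
    rw [Metric.mem_eball, edist_dist, Real.dist_eq, sub_zero]
    exact lt_of_lt_of_le ((ENNReal.ofReal_lt_ofReal_iff hr0).2 hur) (hrad r hr0 hrR)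
  · rw [hsum]; exact (h u h0 hu).tsum_eq
  · rw [hsum, tsum_eq_single 0 (fun n hn => by simp [hn])]; simp

/-- The sum of a power series is its quadratic Taylor polynomial plus a cubic analytic remainder. -/
theorem exists_cubic_remainder {c : ℕ → ℝ} {R : ℝ} {f : ℝ → ℝ} (hR : 0 < R)
    (h : ∀ u, 0 < u → u < R → HasSum (fun n => c n * u ^ n) (f u)) :
    ∃ g : ℝ → ℝ, AnalyticAt ℝ g 0 ∧
      ∀ u, 0 < u → u < R → f u = c 0 + c 1 * u + c 2 * u ^ 2 + u ^ 3 * g u := by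
  have h3 : ∀ u, 0 < u → u < R → HasSum (fun n => c (n + 3) * u ^ n)
      ((f u - (c 0 + c 1 * u + c 2 * u ^ 2)) / u ^ 3) := fun u hu huR => by
    have h1 := (hasSum_nat_add_iff' 3).2 (h u hu huR)
    have h2 := h1.div_const (u ^ 3)
    simp only [Finset.sum_range_succ, Finset.sum_range_zero] at h2
    have e : f u - (0 + c 0 * u ^ 0 + c 1 * u ^ 1 + c 2 * u ^ 2)
        = f u - (c 0 + c 1 * u + c 2 * u ^ 2) := by ring
    rw [e] at h2
    have e' : (fun n => c (n + 3) * u ^ (n + 3) / u ^ 3) = fun n => c (n + 3) * u ^ n := by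
      ext n
      rw [pow_add, ← mul_assoc, mul_div_cancel_right₀ _ (by positivity)]
    rwa [e'] at h2
  obtain ⟨g, hg, hgf, -⟩ := exists_analyticAt_of_hasSum_pow hR h3
  refine ⟨g, hg 0 (by simpa using hR), fun u hu huR => ?_⟩
  rw [hgf u hu huR]
  field_simp
  ring

namespace Potentials

theorem differentiableAt_A (P : Potentials β γ ε) {u : ℝ} (h0 : 0 < u) (h1 : u < 1 / P.ρ) :
    DifferentiableAt ℝ P.A u := by
  obtain ⟨F, hF, hFA, -⟩ := exists_analyticAt_of_hasSum_pow (one_div_pos.2 P.ρ_pos) P.hasSum_A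
  refine (hF u (by rwa [abs_of_pos h0])).differentiableAt.congr_of_eventuallyEq ?_
  filter_upwards [Ioo_mem_nhds h0 h1] with v hv
  exact (hFA v hv.1 hv.2).symm

theorem differentiableAt_inv_B (P : Potentials β γ ε) {u : ℝ} (h0 : 0 < u) (h1 : u < 1 / P.ρ) :
    DifferentiableAt ℝ (fun v => 1 / P.B v) u := by
  obtain ⟨F, hF, hFA, -⟩ := exists_analyticAt_of_hasSum_pow (one_div_pos.2 P.ρ_pos) P.hasSum_B
  refine (hF u (by rwa [abs_of_pos h0])).differentiableAt.congr_of_eventuallyEq ?_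
  filter_upwards [Ioo_mem_nhds h0 h1] with v hv
  exact (hFA v hv.1 hv.2).symm

theorem continuousAt_B (P : Potentials β γ ε) {u : ℝ} (h0 : 0 < u) (h1 : u < 1 / P.ρ) :
    ContinuousAt P.B u := by
  have := (P.differentiableAt_inv_B h0 h1).continuousAt.inv₀
    (one_div_pos.2 (P.B_pos u h0 h1)).ne'
  have e : (fun v => 1 / P.B v)⁻¹ = P.B := by ext v; simp
  rwa [e] at this

/-- The square of the refractive index, as a function of `u = m / r`. -/
def indexSq (P : Potentials β γ ε) (u : ℝ) : ℝ := (1 / P.B u) / P.A u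

theorem indexSq_pos (P : Potentials β γ ε) {u : ℝ} (h0 : 0 < u) (h1 : u < 1 / P.ρ) :
    0 < P.indexSq u :=
  div_pos (one_div_pos.2 (P.B_pos u h0 h1)) (P.A_pos u h0 h1)

theorem hasDerivAt_indexSq (P : Potentials β γ ε) {u : ℝ} (h0 : 0 < u) (h1 : u < 1 / P.ρ) :
    HasDerivAt P.indexSq ((deriv (fun v => 1 / P.B v) u * P.A u - 1 / P.B u * deriv P.A u)
      / P.A u ^ 2) u :=
  (P.differentiableAt_inv_B h0 h1).hasDerivAt.div (P.differentiableAt_A h0 h1).hasDerivAt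
    (P.A_pos u h0 h1).ne'

/-- Here `κ` gets its meaning: `2κ` is the number for which `1/ℬ` and `(1 + 2(1+γ)u + 2κu²)𝒜` agree
through order `u²`. -/
theorem indexSq_expansion (P : Potentials β γ ε) :
    ∃ g : ℝ → ℝ, AnalyticAt ℝ g 0 ∧ ∀ᶠ u in 𝓝[>] (0 : ℝ), P.indexSq u =
      1 + 2 * (1 + γ) * u + 2 * kappa β γ ε * u ^ 2 + u ^ 3 * g u := by
  have hR := one_div_pos.2 P.ρ_pos
  obtain ⟨gA, hgA, hA⟩ := exists_cubic_remainder hR P.hasSum_A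
  obtain ⟨gB, hgB, hB⟩ := exists_cubic_remainder hR P.hasSum_B
  obtain ⟨F, hF, hFA, hF0⟩ := exists_analyticAt_of_hasSum_pow hR P.hasSum_A
  have hF0' : AnalyticAt ℝ F 0 := hF 0 (by simpa using hR)
  set k := kappa β γ ε with hk
  -- The subtracted polynomial collects the terms of order 3 and 4 of the product of the two
  -- quadratic polynomials. The denominator is the analytic extension `F` of `P.A`, because `P.A`
  -- itself is unconstrained at `0`.
  refine ⟨fun u => (gB u - (1 + 2 * (1 + γ) * u + 2 * k * u ^ 2) * gA u
      - (4 * β * (1 + γ) - 4 * k + 4 * β * k * u)) / F u, ?_, ?_⟩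
  · refine AnalyticAt.div ?_ hF0' (by rw [hF0, P.aCoeff_zero]; norm_num)
    fun_prop
  · filter_upwards [Ioo_mem_nhdsGT hR] with u hu
    have hAu := hA u hu.1 hu.2
    have hBu := hB u hu.1 hu.2
    have hpos := P.A_pos u hu.1 hu.2
    rw [P.aCoeff_zero, P.aCoeff_one, P.aCoeff_two] at hAu
    rw [P.bCoeff_zero, P.bCoeff_one, P.bCoeff_two] at hBu
    simp only [indexSq, hFA u hu.1 hu.2]
    rw [div_eq_iff hpos.ne', add_mul, mul_div_assoc', div_mul_cancel₀ _ hpos.ne', hBu]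
    rw [hAu, hk, kappa]
    ring

set_option maxHeartbeats 600000 in
/-- Bounds on the potentials for small `u = m / r`. -/
theorem exists_weak_field_bounds (P : Potentials β γ ε) :
    ∃ u₁ K : ℝ, 0 < u₁ ∧ u₁ ≤ 1 / P.ρ ∧ 1 ≤ K ∧ ∀ u, 0 < u → u < u₁ →
      |deriv P.indexSq u / 2 - ((1 + γ) + 2 * kappa β γ ε * u)| ≤ K * u ^ 2 ∧
      |P.indexSq u - 1| ≤ K * u ∧ |deriv P.indexSq u / 2| ≤ K ∧
      1 / 2 ≤ P.B u ∧ P.indexSq u ≤ 2 ∧ 1 / 2 ≤ P.indexSq u := by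
  have hR := one_div_pos.2 P.ρ_pos
  obtain ⟨g, hg, hgN⟩ := P.indexSq_expansion
  set k := kappa β γ ε with hk
  obtain ⟨FB, hFB, hFBB, hFB0⟩ := exists_analyticAt_of_hasSum_pow hR P.hasSum_B
  have hBt : ∀ᶠ u in 𝓝[>] (0 : ℝ), FB u < 2 := by
    refine ((hFB 0 (by simpa using hR)).continuousAt.tendsto.mono_left nhdsWithin_le_nhds).eventually
      (gt_mem_nhds ?_)
    rw [hFB0, P.bCoeff_zero]; norm_num
  have hgb : ∀ᶠ u in 𝓝[>] (0 : ℝ), |g u| < |g 0| + 1 :=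
    (hg.continuousAt.abs.tendsto.mono_left nhdsWithin_le_nhds).eventually
      (gt_mem_nhds (lt_add_one _))
  have hgb' : ∀ᶠ u in 𝓝[>] (0 : ℝ), |deriv g u| < |deriv g 0| + 1 :=
    (hg.deriv.continuousAt.abs.tendsto.mono_left nhdsWithin_le_nhds).eventually
      (gt_mem_nhds (lt_add_one _))
  have hdiff : ∀ᶠ u in 𝓝[>] (0 : ℝ), AnalyticAt ℝ g u :=
    hg.eventually_analyticAt.filter_mono nhdsWithin_le_nhds
  -- One constant large enough for all the estimates. Cutting `u` at `1/(2K)` then turns `|N - 1| ≤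
  -- K u` into `1/2 ≤ N ≤ 3/2`.
  set K : ℝ := 1 + 2 * |1 + γ| + 2 * |k| + 3 * (|g 0| + 1) + (|deriv g 0| + 1) with hK
  have hK1 : 1 ≤ K := by
    have := abs_nonneg (1 + γ); have := abs_nonneg k; have := abs_nonneg (g 0)
    have := abs_nonneg (deriv g 0)
    rw [hK]; linarith
  have hev := hBt.and (hgb.and (hgb'.and (hdiff.and (hgN.and
    ((Ioo_mem_nhdsGT hR : Set.Ioo 0 (1 / P.ρ) ∈ 𝓝[>] (0 : ℝ)))))))
  obtain ⟨u₀, hu₀, hsub⟩ := mem_nhdsGT_iff_exists_Ioo_subset.1 hev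
  have hu₀' : 0 < u₀ := hu₀
  have hKi : 0 < 1 / (2 * K) := by positivity
  refine ⟨min (min u₀ (1 / P.ρ)) (min 1 (1 / (2 * K))), K, by simp only [lt_min_iff]; exact
    ⟨⟨hu₀', hR⟩, one_pos, hKi⟩,
    (min_le_left _ _).trans (min_le_right _ _), hK1, fun u h0 hu => ?_⟩
  simp only [lt_min_iff] at hu
  obtain ⟨⟨hu1, hu2⟩, hu3, hu4⟩ := hu
  obtain ⟨hB, hb1, hb2, hd, hN, -⟩ := hsub ⟨h0, hu1⟩
  -- The expansion may be differentiated because it holds on an open interval around `u`, not only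
  -- in the limit at `0`.
  have hder : deriv P.indexSq u = 2 * (1 + γ) + 4 * k * u + 3 * u ^ 2 * g u + u ^ 3 * deriv g u := by
    have hloc : P.indexSq =ᶠ[𝓝 u] fun u =>
        1 + 2 * (1 + γ) * u + 2 * k * u ^ 2 + u ^ 3 * g u := by
      filter_upwards [Ioo_mem_nhds h0 hu1] with v hv
      exact (hsub hv).2.2.2.2.1
    rw [hloc.deriv_eq]
    have hpoly : HasDerivAt (fun u : ℝ => 1 + 2 * (1 + γ) * u + 2 * k * u ^ 2 + u ^ 3 * g u)
        (0 + 2 * (1 + γ) * 1 + 2 * k * ((2 : ℕ) * u ^ (2 - 1) * 1)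
          + ((3 : ℕ) * u ^ (3 - 1) * 1 * g u + u ^ 3 * deriv g u)) u :=
      ((((hasDerivAt_const u (1 : ℝ)).add ((hasDerivAt_id u).const_mul _)).add
        (((hasDerivAt_id u).pow 2).const_mul _)).add
        (((hasDerivAt_id u).pow 3).mul hd.differentiableAt.hasDerivAt))
    rw [hpoly.deriv]
    push_cast
    ring
  have hu2' : u ^ 2 ≤ u := by nlinarith
  have hu3' : u ^ 3 ≤ u := by nlinarith [sq_nonneg u]
  have hu32 : u ^ 3 ≤ u ^ 2 := by nlinarith [sq_nonneg u]
  have h1 : |u ^ 2 * g u| ≤ u ^ 2 * (|g 0| + 1) := by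
    rw [abs_mul, abs_of_nonneg (sq_nonneg u)]; gcongr
  have h2 : |u ^ 3 * deriv g u| ≤ u ^ 2 * (|deriv g 0| + 1) := by
    rw [abs_mul, abs_of_nonneg (by positivity : 0 ≤ u ^ 3)]; gcongr
  have h3 : |u ^ 3 * g u| ≤ u * (|g 0| + 1) := by
    rw [abs_mul, abs_of_nonneg (by positivity : 0 ≤ u ^ 3)]; gcongr
  have hg0 := abs_nonneg (g 0)
  have hg0' := abs_nonneg (deriv g 0)
  have ha0 := abs_nonneg (1 + γ)
  have hk0 := abs_nonneg k
  have hm1 : |deriv P.indexSq u / 2 - ((1 + γ) + 2 * k * u)| ≤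
      (3 / 2 * (|g 0| + 1) + 1 / 2 * (|deriv g 0| + 1)) * u ^ 2 := by
    rw [hder, show (2 * (1 + γ) + 4 * k * u + 3 * u ^ 2 * g u + u ^ 3 * deriv g u) / 2
      - ((1 + γ) + 2 * k * u) = 3 / 2 * (u ^ 2 * g u) + 1 / 2 * (u ^ 3 * deriv g u) by ring]
    refine (abs_add_le _ _).trans ?_
    rw [abs_mul, abs_mul (1 / 2), abs_of_pos (by norm_num : (0 : ℝ) < 3 / 2),
      abs_of_pos (by norm_num : (0 : ℝ) < 1 / 2)]
    linarith
  have hku : |k * u| ≤ |k| * u := by rw [abs_mul, abs_of_pos h0]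
  have hku2 : |k * u ^ 2| ≤ |k| * u := by
    rw [abs_mul, abs_of_nonneg (sq_nonneg u)]; gcongr
  have hau : |(1 + γ) * u| ≤ |1 + γ| * u := by rw [abs_mul, abs_of_pos h0]
  have hm2 : |P.indexSq u - 1| ≤ K * u := by
    rw [hN, show 1 + 2 * (1 + γ) * u + 2 * k * u ^ 2 + u ^ 3 * g u - 1
      = 2 * ((1 + γ) * u) + 2 * (k * u ^ 2) + u ^ 3 * g u by ring]
    have e1 := abs_add_three (2 * ((1 + γ) * u)) (2 * (k * u ^ 2)) (u ^ 3 * g u)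
    rw [abs_mul 2, abs_mul 2 (k * u ^ 2), abs_two] at e1
    have e2 : K * u = u + 2 * (|1 + γ| * u) + 2 * (|k| * u) + 3 * (u * (|g 0| + 1))
        + u * (|deriv g 0| + 1) := by rw [hK]; ring
    have e3 : 0 ≤ u * (|g 0| + 1) := by positivity
    have e4 : 0 ≤ u * (|deriv g 0| + 1) := by positivity
    rw [e2]; linarith
  have hKu : K * u ≤ 1 / 2 := by
    rw [lt_div_iff₀ (by linarith)] at hu4
    linarith
  refine ⟨hm1.trans ?_, hm2, ?_, ?_, ?_, ?_⟩
  · have : 0 ≤ u ^ 2 := sq_nonneg u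
    refine mul_le_mul_of_nonneg_right ?_ this
    rw [hK]; linarith
  · have e1 : |deriv P.indexSq u / 2| ≤ |deriv P.indexSq u / 2 - ((1 + γ) + 2 * k * u)|
        + |(1 + γ) + 2 * k * u| := by
      have := abs_add_le (deriv P.indexSq u / 2 - ((1 + γ) + 2 * k * u)) ((1 + γ) + 2 * k * u)
      simpa using this
    have e2 := abs_add_le (1 + γ) (2 * k * u)
    rw [mul_assoc] at hm1 e1
    rw [mul_assoc, abs_mul 2, abs_two] at e2
    have e3 : |k| * u ≤ |k| := mul_le_of_le_one_right hk0 hu3.le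
    have e4 : (3 / 2 * (|g 0| + 1) + 1 / 2 * (|deriv g 0| + 1)) * u ^ 2 ≤
        3 / 2 * (|g 0| + 1) + 1 / 2 * (|deriv g 0| + 1) :=
      mul_le_of_le_one_right (by positivity) (hu2'.trans hu3.le)
    rw [hK]; linarith
  · rw [hFBB u h0 hu2] at hB
    have hBpos := P.B_pos u h0 hu2
    rw [div_lt_iff₀ hBpos] at hB
    linarith
  · have := (abs_le.1 hm2).2; linarith
  · have := (abs_le.1 hm2).1; linarith

end Potentials

/-! ### From null geodesics to a central force -/

theorem Triple.norm_sq_eq_sum (v : Triple) : ‖v‖ ^ 2 = ∑ i, v i ^ 2 := by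
  rw [EuclideanSpace.norm_sq_eq]
  simp

/-- The spatial part of a quadruple, as a continuous linear map. -/
def Event.spaceL : Event →L[ℝ] Triple :=
  ((EuclideanSpace.equiv (Fin 3) ℝ).symm : (Fin 3 → ℝ) →L[ℝ] Triple).comp
    (ContinuousLinearMap.pi fun i : Fin 3 => ContinuousLinearMap.proj i.succ)

theorem Event.spaceL_apply (z : Event) : Event.spaceL z = z.space := rfl

/-- A function of the Newtonian potential `m / r` has a central gradient. -/
theorem hasFDerivAt_comp_div_norm_space {φ : ℝ → ℝ} {φ' m : ℝ} {z : Event}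
    (hz : z.space ≠ 0) (hφ : HasDerivAt φ φ' (m / ‖z.space‖)) :
    HasFDerivAt (fun y : Event => φ (m / ‖y.space‖))
      ((-(φ' * m / ‖z.space‖ ^ 3)) • ((innerSL ℝ z.space).comp Event.spaceL)) z := by
  have hr : 0 < ‖z.space‖ := norm_pos_iff.2 hz
  -- The norm is treated as the square root of its square, which is smooth.
  have h1 : HasFDerivAt (fun y : Event => ‖Event.spaceL y‖ ^ 2)
      (2 • (innerSL ℝ (Event.spaceL z)).comp Event.spaceL) z :=
    (Event.spaceL.hasFDerivAt).norm_sq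
  have h2 : HasDerivAt (fun q : ℝ => m / Real.sqrt q)
      (-(m * (1 / (2 * Real.sqrt (‖z.space‖ ^ 2)))) / (Real.sqrt (‖z.space‖ ^ 2)) ^ 2)
      (‖z.space‖ ^ 2) := by
    have := (hasDerivAt_const (‖z.space‖ ^ 2) m).div
      (Real.hasDerivAt_sqrt (x := ‖z.space‖ ^ 2) (by positivity)) (by positivity)
    rw [zero_mul, zero_sub] at this
    exact this
  have h3 : HasDerivAt (fun q : ℝ => φ (m / Real.sqrt q))
      (φ' * (-(m * (1 / (2 * Real.sqrt (‖z.space‖ ^ 2)))) / (Real.sqrt (‖z.space‖ ^ 2)) ^ 2))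
      (‖z.space‖ ^ 2) := by
    refine HasDerivAt.comp (‖z.space‖ ^ 2) (h₂ := φ) ?_ h2
    rwa [Real.sqrt_sq hr.le]
  have h4 := h3.comp_hasFDerivAt z h1
  refine (h4.congr_fderiv ?_).congr_of_eventuallyEq (Eventually.of_forall fun y => ?_)
  · ext v
    simp only [Real.sqrt_sq hr.le, Event.spaceL_apply, _root_.smul_apply, smul_eq_mul,
      nsmul_eq_mul]
    field_simp
    simp
  · simp [Event.spaceL_apply, Real.sqrt_sq]

theorem hasDerivWithinAt_triple {f : ℝ → Triple} {f' : Triple} {s : Set ℝ} {t : ℝ}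
    (h : ∀ i, HasDerivWithinAt (fun τ => f τ i) (f' i) s t) : HasDerivWithinAt f f' s t := by
  rw [hasDerivWithinAt_iff_hasFDerivWithinAt]
  rw [hasFDerivWithinAt_euclidean]
  intro i
  have := (h i).hasFDerivWithinAt
  refine this.congr_fderiv ?_
  ext
  simp

/-- The equations of motion of a light ray in isotropic coordinates: `T` is the coordinate time,
`x` the position, `E` the conserved covariant time component, and `p` the opposite of the direction
triple. -/
structure IsReducedRay (P : Potentials β γ ε) (m E σB : ℝ) (T : ℝ → ℝ) (x p : ℝ → Triple) :
    Prop where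
  exterior : ∀ σ ≤ σB, P.ρ * m < ‖x σ‖
  time : ∀ σ ≤ σB, HasDerivWithinAt T (E / P.A (m / ‖x σ‖)) (Set.Iic σB) σ
  position : ∀ σ ≤ σB, HasDerivWithinAt x ((E * P.B (m / ‖x σ‖)) • p σ) (Set.Iic σB) σ
  momentum : ∀ σ ≤ σB, HasDerivWithinAt p
    ((-(E * P.B (m / ‖x σ‖) * (m / ‖x σ‖ ^ 3) * (deriv P.indexSq (m / ‖x σ‖) / 2))) • x σ)
    (Set.Iic σB) σ
  norm_sq : ∀ σ ≤ σB, ‖p σ‖ ^ 2 = P.indexSq (m / ‖x σ‖)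

namespace Potentials

theorem div_norm_mem (P : Potentials β γ ε) {m r : ℝ} (hm : 0 < m) (hr : P.ρ * m < r) :
    0 < m / r ∧ m / r < 1 / P.ρ := by
  have hρ := P.ρ_pos
  have hr0 : 0 < r := lt_trans (mul_pos hρ hm) hr
  refine ⟨div_pos hm hr0, ?_⟩
  rw [div_lt_div_iff₀ hr0 hρ]
  linarith

theorem covTangent_metric_zero (P : Potentials β γ ε) (m σB : ℝ) (z : ℝ → Event) (σ : ℝ) :
    covTangent (P.metric m) σB z σ 0 = P.A (m / ‖(z σ).space‖) * tangent σB z σ 0 := by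
  simp [covTangent, metric, Matrix.diagonal_apply]

theorem covTangent_metric_succ (P : Potentials β γ ε) (m σB : ℝ) (z : ℝ → Event) (σ : ℝ)
    (i : Fin 3) : covTangent (P.metric m) σB z σ i.succ =
      -(1 / P.B (m / ‖(z σ).space‖)) * tangent σB z σ i.succ := by
  simp [covTangent, metric, Matrix.diagonal_apply]

theorem sum_metric (P : Potentials β γ ε) (m : ℝ) (z v : Event) :
    ∑ μ, ∑ ν, P.metric m z μ ν * v μ * v ν =
      P.A (m / ‖z.space‖) * v 0 ^ 2 - 1 / P.B (m / ‖z.space‖) * ‖v.space‖ ^ 2 := by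
  rw [Triple.norm_sq_eq_sum]
  simp [metric, Matrix.diagonal_apply, Fin.sum_univ_succ, Event.space]
  ring

/-- Every entry depends on the event through `m / r` only, so all partial derivatives share one
radial factor. It vanishes for `α = 0`, which yields conservation of energy, and is proportional to
the position for spatial `α`, which makes the force central. -/
theorem sum_metricPartial (P : Potentials β γ ε) (m : ℝ) (z v : Event) (α : Fin 4) {A' B' : ℝ}
    (hz : z.space ≠ 0)
    (hA : HasDerivAt P.A A' (m / ‖z.space‖))
    (hB : HasDerivAt (fun u => 1 / P.B u) B' (m / ‖z.space‖)) :
    ∑ μ, ∑ ν, metricPartial (P.metric m) z α μ ν * v μ * v ν =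
      -(m / ‖z.space‖ ^ 3) * inner ℝ z.space (Event.space (Pi.single α 1)) *
        (A' * v 0 ^ 2 - B' * ‖v.space‖ ^ 2) := by
  have hoff : ∀ μ ν, μ ≠ ν → metricPartial (P.metric m) z α μ ν = 0 := fun μ ν h => by
    have : (fun y => P.metric m y μ ν) = fun _ => 0 := by
      ext y; simp [metric, h]
    simp [metricPartial, this]
  have h0 : metricPartial (P.metric m) z α 0 0 =
      -(A' * m / ‖z.space‖ ^ 3) * inner ℝ z.space (Event.space (Pi.single α 1)) := by
    have : (fun y => P.metric m y 0 0) = fun y => P.A (m / ‖y.space‖) := by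
      ext y; simp [metric]
    rw [metricPartial, this, (hasFDerivAt_comp_div_norm_space hz hA).fderiv]
    simp [Event.spaceL_apply]
  have hs : ∀ i : Fin 3, metricPartial (P.metric m) z α i.succ i.succ =
      (B' * m / ‖z.space‖ ^ 3) * inner ℝ z.space (Event.space (Pi.single α 1)) := fun i => by
    have : (fun y => P.metric m y i.succ i.succ) = fun y => -(1 / P.B (m / ‖y.space‖)) := by
      ext y; simp [metric]
    rw [metricPartial, this,
      HasFDerivAt.fderiv (f := fun y : Event => -(1 / P.B (m / ‖y.space‖)))
        (hasFDerivAt_comp_div_norm_space hz hB).neg]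
    simp [Event.spaceL_apply]
  have hsum : ∀ μ, ∑ ν, metricPartial (P.metric m) z α μ ν * v μ * v ν =
      metricPartial (P.metric m) z α μ μ * v μ ^ 2 := fun μ => by
    rw [Finset.sum_eq_single μ (fun ν _ h => by rw [hoff μ ν h.symm]; ring) (by simp)]
    ring
  simp_rw [hsum]
  rw [Fin.sum_univ_succ, h0]
  simp_rw [hs]
  rw [← Finset.mul_sum, Triple.norm_sq_eq_sum]
  simp only [Event.space]
  ring

end Potentials

theorem Event.space_single_zero : Event.space (Pi.single 0 1) = 0 := by
  ext i
  simp [Event.space]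

theorem Event.inner_space_single_succ (v : Triple) (i : Fin 3) :
    inner ℝ v (Event.space (Pi.single i.succ 1)) = v i := by
  have : Event.space (Pi.single i.succ 1) = EuclideanSpace.single i (1 : ℝ) := by
    ext j
    simp [Event.space, Pi.single_apply]
  rw [this, EuclideanSpace.inner_single_right]
  simp

/-- A null geodesic in the exterior region obeys the equations of motion of a light ray. -/
theorem IsNullGeodesic.exists_isReducedRay {P : Potentials β γ ε} {m σB : ℝ} {z : ℝ → Event}
    (hz : IsNullGeodesic (P.metric m) σB z) (hm : 0 < m)
    (hext : ∀ σ ≤ σB, P.ρ * m < ‖(z σ).space‖) :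
    ∃ E : ℝ, E ≠ 0 ∧ IsReducedRay P m E σB (fun σ => z σ 0) (fun σ => (z σ).space)
      (fun σ => -directionTriple (P.metric m) σB z σ) ∧
      ∀ σ ≤ σB, P.indexSq (m / ‖(z σ).space‖) • coordVelocity σB z σ =
        -directionTriple (P.metric m) σB z σ := by
  have hr : ∀ σ ≤ σB, 0 < ‖(z σ).space‖ := fun σ hσ =>
    lt_trans (mul_pos P.ρ_pos hm) (hext σ hσ)
  have hu := fun σ hσ => P.div_norm_mem hm (hext σ hσ)
  have hApos := fun σ hσ => P.A_pos _ (hu σ hσ).1 (hu σ hσ).2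
  have hBpos := fun σ hσ => P.B_pos _ (hu σ hσ).1 (hu σ hσ).2
  have htan : ∀ σ ≤ σB, ∀ α, HasDerivWithinAt (fun τ => z τ α) (tangent σB z σ α)
      (Set.Iic σB) σ := fun σ hσ α =>
    hasDerivWithinAt_pi.1 (hz.differentiable σ hσ).hasDerivWithinAt α
  have hgeo : ∀ σ ≤ σB, ∀ α, HasDerivWithinAt (fun τ => covTangent (P.metric m) σB z τ α)
      ((1 / 2) * (-(m / ‖(z σ).space‖ ^ 3) * inner ℝ (z σ).space (Event.space (Pi.single α 1)) *
        (deriv P.A (m / ‖(z σ).space‖) * tangent σB z σ 0 ^ 2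
          - deriv (fun u => 1 / P.B u) (m / ‖(z σ).space‖) * ‖(tangent σB z σ).space‖ ^ 2)))
      (Set.Iic σB) σ := fun σ hσ α => by
    have := hz.geodesic σ hσ α
    rwa [P.sum_metricPartial m (z σ) _ α (norm_pos_iff.1 (hr σ hσ))
      (P.differentiableAt_A (hu σ hσ).1 (hu σ hσ).2).hasDerivAt
      (P.differentiableAt_inv_B (hu σ hσ).1 (hu σ hσ).2).hasDerivAt] at this
  set E := covTangent (P.metric m) σB z σB 0 with hE
  have hconst : ∀ σ ≤ σB, covTangent (P.metric m) σB z σ 0 = E := fun σ hσ => by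
    have hd : ∀ τ ∈ Set.Iic σB, HasDerivWithinAt (fun τ => covTangent (P.metric m) σB z τ 0) 0
        (Set.Iic σB) τ := fun τ hτ => by
      have := hgeo τ hτ 0
      rw [Event.space_single_zero] at this
      simpa using this
    have h := (convex_Iic σB).norm_image_sub_le_of_norm_hasDerivWithin_le (C := 0) hd
      (fun τ _ => by simp) (Set.mem_Iic.2 hσ) (Set.mem_Iic.2 le_rfl)
    rw [zero_mul] at h
    exact (sub_eq_zero.1 (norm_le_zero_iff.1 h)).symm
  have hT : ∀ σ ≤ σB, tangent σB z σ 0 = E / P.A (m / ‖(z σ).space‖) := fun σ hσ => by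
    rw [← hconst σ hσ, P.covTangent_metric_zero, mul_div_cancel_left₀ _ (hApos σ hσ).ne']
  have hnull : ∀ σ ≤ σB, P.A (m / ‖(z σ).space‖) * tangent σB z σ 0 ^ 2 =
      1 / P.B (m / ‖(z σ).space‖) * ‖(tangent σB z σ).space‖ ^ 2 := fun σ hσ => by
    have := hz.null σ hσ
    rw [P.sum_metric] at this
    linarith
  -- With `E = 0` the time component of the tangent vanishes, and then nullity kills the spatial
  -- part too.
  have hE0 : E ≠ 0 := by
    intro h0
    have h1 := hT σB le_rfl
    rw [h0, zero_div] at h1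
    have h2 := hnull σB le_rfl
    rw [h1] at h2
    have h3 : ‖(tangent σB z σB).space‖ = 0 := by
      have := one_div_pos.2 (hBpos σB le_rfl)
      have h4 : ‖(tangent σB z σB).space‖ ^ 2 = 0 := by
        rcases mul_eq_zero.1 (h2.symm.trans (by ring)) with h | h
        · exact absurd h this.ne'
        · exact h
      exact pow_eq_zero_iff (two_ne_zero) |>.1 h4
    refine hz.tangent_ne_zero σB le_rfl (funext fun α => ?_)
    refine Fin.cases h1 (fun i => ?_) α
    have := congrFun (congrArg WithLp.ofLp (norm_eq_zero.1 h3)) i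
    simpa [Event.space] using this
  have hp : ∀ σ ≤ σB, ∀ i : Fin 3, (-directionTriple (P.metric m) σB z σ) i =
      1 / P.B (m / ‖(z σ).space‖) * tangent σB z σ i.succ / E := fun σ hσ i => by
    simp only [directionTriple, PiLp.neg_apply, P.covTangent_metric_succ, hconst σ hσ]
    ring
  have hspace : ∀ σ ≤ σB, (tangent σB z σ).space =
      (E * P.B (m / ‖(z σ).space‖)) • (-directionTriple (P.metric m) σB z σ) := fun σ hσ => by
    ext i
    have := (hBpos σ hσ).ne'
    rw [PiLp.smul_apply, hp σ hσ i, smul_eq_mul]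
    generalize P.B (m / ‖(z σ).space‖) = b at this ⊢
    simp only [Event.space]
    field_simp
  have hnorm : ∀ σ ≤ σB, ‖-directionTriple (P.metric m) σB z σ‖ ^ 2 =
      P.indexSq (m / ‖(z σ).space‖) := fun σ hσ => by
    have h := hnull σ hσ
    have hb := hBpos σ hσ
    have ha := hApos σ hσ
    rw [hspace σ hσ, hT σ hσ, norm_smul, mul_pow, Real.norm_eq_abs, sq_abs] at h
    rw [Potentials.indexSq]
    field_simp at h ⊢
    linarith
  refine ⟨E, hE0, ⟨hext, fun σ hσ => ?_, fun σ hσ => ?_, fun σ hσ => ?_, hnorm⟩, fun σ hσ => ?_⟩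
  · rw [← hT σ hσ]; exact htan σ hσ 0
  · rw [← hspace σ hσ]
    exact hasDerivWithinAt_triple fun i => htan σ hσ i.succ
  · refine hasDerivWithinAt_triple fun i => ?_
    have h1 := ((hgeo σ hσ i.succ).neg.div_const E)
    have h2 : HasDerivWithinAt (fun τ => (-directionTriple (P.metric m) σB z τ) i) _
      (Set.Iic σB) σ := h1.congr (fun τ hτ => by
        simp only [directionTriple, PiLp.neg_apply, hconst τ hτ, neg_div, Pi.neg_apply]) (by
        simp only [directionTriple, PiLp.neg_apply, hconst σ hσ, neg_div, Pi.neg_apply])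
    -- Nullity expresses `‖dx/dσ‖²` through `N`, so the terms in `𝒜'` and `(1/ℬ)'` combine into the
    -- derivative of the single function `N = (1/ℬ)/𝒜`.
    refine h2.congr_deriv ?_
    rw [Event.inner_space_single_succ, PiLp.smul_apply, smul_eq_mul,
      (P.hasDerivAt_indexSq (hu σ hσ).1 (hu σ hσ).2).deriv, hspace σ hσ, hT σ hσ, norm_smul,
      mul_pow, hnorm σ hσ, Real.norm_eq_abs, sq_abs, Potentials.indexSq]
    have hb := (hBpos σ hσ).ne'
    have ha := (hApos σ hσ).ne'
    have hr' := (hr σ hσ).ne'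
    field_simp
    ring
  · ext i
    rw [hp σ hσ i]
    have hb := (hBpos σ hσ).ne'
    have ha := (hApos σ hσ).ne'
    simp only [coordVelocity, PiLp.smul_apply, smul_eq_mul, hT σ hσ, Potentials.indexSq]
    field_simp

/-! ### Comparison and power-series estimates -/

section Fencing

variable {V : Type*} [NormedAddCommGroup V] [NormedSpace ℝ V]

theorem HasDerivWithinAt.comp_const_sub_Ici {f : ℝ → V} {f' : V} {b s : ℝ} (hs : 0 ≤ s)
    (h : HasDerivWithinAt f f' (Set.Iic b) (b - s)) :
    HasDerivWithinAt (fun t => f (b - t)) (-f') (Set.Ici s) s := by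
  have h1 : HasDerivWithinAt (fun t : ℝ => b - t) (-1) (Set.Ici s) s :=
    ((hasDerivAt_id s).const_sub b).hasDerivWithinAt
  have h2 := h.scomp s h1 (fun t ht => by
    simp only [Set.mem_Iic, Set.mem_Ici] at ht ⊢; linarith)
  rw [neg_one_smul] at h2
  exact h2

/-- Fencing backwards in time: the displacement `‖f σ - f b‖` cannot exceed `g b - g σ` if it grows
more slowly whenever the two are equal. -/
theorem norm_sub_le_of_deriv_lt_of_eq {f f' : ℝ → V} {g g' : ℝ → ℝ} {a b : ℝ}
    (hf : ∀ σ ∈ Set.Icc a b, HasDerivWithinAt f (f' σ) (Set.Iic b) σ)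
    (hg : ∀ σ ∈ Set.Icc a b, HasDerivWithinAt g (g' σ) (Set.Iic b) σ)
    (bound : ∀ σ ∈ Set.Icc a b, ‖f σ - f b‖ = g b - g σ → ‖f' σ‖ < g' σ) :
    ∀ σ ∈ Set.Icc a b, ‖f σ - f b‖ ≤ g b - g σ := by
  intro σ hσ
  -- The reflection `s = b - σ` turns left derivatives into the right derivatives needed for fencing
  -- forwards from `b`.
  have hmem : ∀ s ∈ Set.Icc 0 (b - a), b - s ∈ Set.Icc a b := fun s hs =>
    ⟨by linarith [hs.2], by linarith [hs.1]⟩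
  have hf1 : ∀ s ∈ Set.Icc 0 (b - a), HasDerivWithinAt (fun t => f (b - t) - f b) (-f' (b - s))
      (Set.Ici s) s := fun s hs => ((hf _ (hmem s hs)).comp_const_sub_Ici hs.1).sub_const _
  have hg1 : ∀ s ∈ Set.Icc 0 (b - a), HasDerivWithinAt (fun t => g b - g (b - t)) (g' (b - s))
      (Set.Ici s) s := fun s hs => by
    simpa using ((hg _ (hmem s hs)).comp_const_sub_Ici hs.1).const_sub (g b)
  have hcf : ContinuousOn (fun t => f (b - t) - f b) (Set.Icc 0 (b - a)) := by
    refine ContinuousOn.sub (ContinuousOn.comp (t := Set.Icc a b) (g := f) ?_ (by fun_prop) hmem)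
      continuousOn_const
    exact fun τ hτ => ((hf τ hτ).continuousWithinAt).mono (fun _ h => h.2)
  have hcg : ContinuousOn (fun t => g b - g (b - t)) (Set.Icc 0 (b - a)) := by
    refine ContinuousOn.sub continuousOn_const
      (ContinuousOn.comp (t := Set.Icc a b) (g := g) ?_ (by fun_prop) hmem)
    exact fun τ hτ => ((hg τ hτ).continuousWithinAt).mono (fun _ h => h.2)
  have key := image_norm_le_of_norm_deriv_right_lt_deriv_boundary' hcf
    (fun s hs => hf1 s ⟨hs.1, hs.2.le⟩) (by simp) hcg (fun s hs => hg1 s ⟨hs.1, hs.2.le⟩)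
    (fun s hs he => by
      rw [norm_neg]; exact bound _ (hmem s ⟨hs.1, hs.2.le⟩) he)
  have := key (x := b - σ) ⟨by linarith [hσ.2], by linarith [hσ.1]⟩
  simpa using this

/-- Adding a slope `e / (b - a + 1)` to `g` makes the inequality strict, at a cost of at most `e`;
then `e → 0`. The `+ 1` covers `a = b`. -/
theorem norm_sub_le_of_deriv_le {f f' : ℝ → V} {g g' : ℝ → ℝ} {a b : ℝ} (hab : a ≤ b)
    (hf : ∀ σ ∈ Set.Icc a b, HasDerivWithinAt f (f' σ) (Set.Iic b) σ)
    (hg : ∀ σ ∈ Set.Icc a b, HasDerivWithinAt g (g' σ) (Set.Iic b) σ)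
    (bound : ∀ σ ∈ Set.Icc a b, ‖f' σ‖ ≤ g' σ) : ‖f a - f b‖ ≤ g b - g a := by
  refine le_of_forall_pos_le_add fun e he => ?_
  have hd : 0 < e / (b - a + 1) := div_pos he (by linarith)
  have h := norm_sub_le_of_deriv_lt_of_eq (g := fun σ => g σ + e / (b - a + 1) * σ)
    (g' := fun σ => g' σ + e / (b - a + 1) * 1) hf
    (fun σ hσ => (hg σ hσ).add ((hasDerivWithinAt_id σ _).const_mul _))
    (fun σ hσ _ => by have := bound σ hσ; simp only [mul_one]; linarith) a ⟨le_rfl, hab⟩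
  have e1 : e / (b - a + 1) * (b - a) ≤ e := by
    rw [div_mul_eq_mul_div, div_le_iff₀ (by linarith)]
    nlinarith
  have : e / (b - a + 1) * (b - a) = e / (b - a + 1) * b - e / (b - a + 1) * a := by ring
  linarith

end Fencing

/-- Summability at `m₀ / 2` bounds the terms there, so for smaller `m` the series is dominated by a
geometric one of size `O(m)`. -/
theorem tendsto_zero_of_hasSum_pow_succ {V : Type*} [NormedAddCommGroup V] [NormedSpace ℝ V]
    {c : ℕ → V} {f : ℝ → V} {m₀ : ℝ} (hm₀ : 0 < m₀)
    (h : ∀ m, 0 < m → m < m₀ → HasSum (fun n => m ^ (n + 1) • c n) (f m)) :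
    Tendsto f (𝓝[>] 0) (𝓝 0) := by
  set m₁ := m₀ / 2 with hm₁
  have hm₁0 : 0 < m₁ := by positivity
  obtain ⟨M, hM⟩ : ∃ M, ∀ n, ‖m₁ ^ (n + 1) • c n‖ ≤ M := by
    have := (h m₁ hm₁0 (by linarith)).summable.tendsto_atTop_zero.norm.bddAbove_range
    obtain ⟨M, hM⟩ := this
    exact ⟨M, fun n => hM ⟨n, rfl⟩⟩
  have hM0 : 0 ≤ M := (norm_nonneg _).trans (hM 0)
  have hb : ∀ m, 0 < m → m < m₁ / 2 → ‖f m‖ ≤ M * (m / m₁) * 2 := fun m hm0 hm => by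
    have hq0 : 0 ≤ m / m₁ := by positivity
    have hq : m / m₁ < 1 / 2 := by rw [div_lt_iff₀ hm₁0]; linarith
    have hgeo := (hasSum_geometric_of_lt_one hq0 (by linarith)).mul_left (M * (m / m₁))
    have h1 : ‖f m‖ ≤ M * (m / m₁) * (1 - m / m₁)⁻¹ := by
      rw [← (h m hm0 (by linarith)).tsum_eq]
      refine tsum_of_norm_bounded hgeo fun n => ?_
      have h2 : m ^ (n + 1) • c n = (m / m₁) ^ (n + 1) • (m₁ ^ (n + 1) • c n) := by
        rw [smul_smul, ← mul_pow, div_mul_cancel₀ _ hm₁0.ne']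
      rw [h2, norm_smul, norm_pow, Real.norm_of_nonneg hq0]
      calc (m / m₁) ^ (n + 1) * ‖m₁ ^ (n + 1) • c n‖ ≤ (m / m₁) ^ (n + 1) * M := by
            gcongr; exact hM n
        _ = M * (m / m₁) * (m / m₁) ^ n := by ring
    refine h1.trans ?_
    have : (1 - m / m₁)⁻¹ ≤ 2 := by
      rw [inv_le_comm₀ (by linarith) (by norm_num)]; linarith
    gcongr
  rw [tendsto_zero_iff_norm_tendsto_zero]
  have hlim : Tendsto (fun m : ℝ => M * (m / m₁) * 2) (𝓝[>] 0) (𝓝 0) := by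
    have : Continuous fun m : ℝ => M * (m / m₁) * 2 := by fun_prop
    have h0 := (this.tendsto 0).mono_left (nhdsWithin_le_nhds (s := Set.Ioi 0))
    simpa using h0
  refine squeeze_zero' (Eventually.of_forall fun _ => norm_nonneg _) ?_ hlim
  filter_upwards [Ioo_mem_nhdsGT (half_pos hm₁0)] with m hm
  exact hb m hm.1 hm.2

/-! ### The direction at reception as `m → 0` -/

namespace IsReducedRay

variable {P : Potentials β γ ε} {m E σB : ℝ} {T : ℝ → ℝ} {x p : ℝ → Triple}

theorem u_mem (h : IsReducedRay P m E σB T x p) (hm : 0 < m) {σ : ℝ} (hσ : σ ≤ σB) :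
    0 < m / ‖x σ‖ ∧ m / ‖x σ‖ < 1 / P.ρ := P.div_norm_mem hm (h.exterior σ hσ)

theorem norm_pos (h : IsReducedRay P m E σB T x p) (hm : 0 < m) {σ : ℝ} (hσ : σ ≤ σB) :
    0 < ‖x σ‖ := lt_trans (mul_pos P.ρ_pos hm) (h.exterior σ hσ)

/-- The derivative of `E T` is `E²/𝒜 ≥ 0`. The product is used because the sign of `E` is not yet
known; this monotonicity is what later determines it. -/
theorem sub_time_mul_energy_nonneg (h : IsReducedRay P m E σB T x p) (hm : 0 < m) {σ₁ σ : ℝ}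
    (h1 : σ₁ ≤ σ) (hσ : σ ≤ σB) : 0 ≤ E * (T σ - T σ₁) := by
  have := norm_sub_le_of_deriv_le (V := ℝ) (f := fun _ => 0) (f' := fun _ => 0)
    (g := fun τ => E * T τ) (g' := fun τ => E * (E / P.A (m / ‖x τ‖))) h1
    (fun τ _ => hasDerivWithinAt_const _ _ _)
    (fun τ hτ => ((h.time τ (hτ.2.trans hσ)).mono (Set.Iic_subset_Iic.2 hσ)).const_mul _)
    (fun τ hτ => by
      have hu := h.u_mem hm (hτ.2.trans hσ)
      have := P.A_pos _ hu.1 hu.2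
      rw [norm_zero, mul_div_assoc']
      have := mul_self_nonneg E
      positivity)
  simp only [sub_zero, norm_zero] at this
  linarith

/-- Over a distance that stays away from the centre, a light ray is straight up to `O(m)`. -/
theorem norm_displacement_sub_le (h : IsReducedRay P m E σB T x p) (hm : 0 < m) (hE : 0 < E)
    {u₁ K R σ₁ : ℝ} (hK : 1 ≤ K)
    (hb : ∀ u, 0 < u → u < u₁ → |P.indexSq u - 1| ≤ K * u ∧ |deriv P.indexSq u / 2| ≤ K ∧
      P.indexSq u ≤ 2 ∧ 1 / 2 ≤ P.indexSq u)
    (hR : 0 < R) (hxB : ‖x σB‖ = R) (hmR : m / (R / 2) < u₁) (hσ₁ : σ₁ ≤ σB)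
    (hT : T σB - T σ₁ ≤ R / 4) :
    ‖(x σB - x σ₁) - (T σB - T σ₁) • p σB‖ ≤ 3 * K * m := by
  have hT0 : ∀ σ ∈ Set.Icc σ₁ σB, 0 ≤ T σB - T σ ∧ T σB - T σ ≤ R / 4 := fun σ hσ => by
    have e1 := h.sub_time_mul_energy_nonneg hm hσ.1 hσ.2
    have e2 := h.sub_time_mul_energy_nonneg hm hσ.2 le_rfl
    rw [mul_nonneg_iff_of_pos_left hE] at e1 e2
    exact ⟨e2, by linarith⟩
  have hfar : ∀ σ ≤ σB, R / 2 ≤ ‖x σ‖ → m / ‖x σ‖ ≤ 2 * m / R ∧ m / ‖x σ‖ < u₁ := fun σ hσ hr => by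
    have : m / ‖x σ‖ ≤ m / (R / 2) := by gcongr
    exact ⟨this.trans (le_of_eq (by field_simp)), lt_of_le_of_lt this hmR⟩
  have hspeed : ∀ σ ≤ σB, E * P.B (m / ‖x σ‖) =
      E / P.A (m / ‖x σ‖) / P.indexSq (m / ‖x σ‖) := fun σ hσ => by
    have hu := h.u_mem hm hσ
    have := (P.A_pos _ hu.1 hu.2).ne'
    have := (P.B_pos _ hu.1 hu.2).ne'
    rw [Potentials.indexSq]
    field_simp
  have hT'pos : ∀ σ ≤ σB, 0 < E / P.A (m / ‖x σ‖) := fun σ hσ =>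
    div_pos hE (P.A_pos _ (h.u_mem hm hσ).1 (h.u_mem hm hσ).2)
  have hp2 : ∀ σ ≤ σB, m / ‖x σ‖ < u₁ → ‖p σ‖ ≤ 2 ∧ ‖p σ‖ / P.indexSq (m / ‖x σ‖) < 2 :=
    fun σ hσ hu => by
      obtain ⟨-, -, h2, h3⟩ := hb _ (h.u_mem hm hσ).1 hu
      have hn := h.norm_sq σ hσ
      rw [← hn] at h2 h3 ⊢
      have h0 := norm_nonneg (p σ)
      have hpos : 0 < ‖p σ‖ := by
        rcases h0.lt_or_eq with h | h
        · exact h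
        · rw [← h] at h3; norm_num at h3
      refine ⟨by nlinarith, ?_⟩
      rw [div_lt_iff₀ (by positivity)]
      nlinarith
  -- A bootstrap: `dx/dT = p/N` has norm below `2` only where the field is weak. Fencing asks for it
  -- only when the displacement equals its bound, which is at most `R / 2`, and there the ray is
  -- still at distance at least `R / 2` from the centre.
  have hx := norm_sub_le_of_deriv_lt_of_eq (a := σ₁) (b := σB) (f := x) (g := fun σ => 2 * T σ)
    (g' := fun σ => 2 * (E / P.A (m / ‖x σ‖)))
    (fun σ hσ => h.position σ hσ.2) (fun σ hσ => (h.time σ hσ.2).const_mul 2)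
    (fun σ hσ he => by
      have hle : ‖x σ - x σB‖ ≤ R / 2 := by
        rw [he]; linarith [(hT0 σ hσ).2]
      have hr : R / 2 ≤ ‖x σ‖ := by
        have := norm_sub_norm_le (x σB) (x σ)
        rw [norm_sub_rev, hxB] at this
        linarith
      have hu := (hfar σ hσ.2 hr).2
      have := (hp2 σ hσ.2 hu).2
      have hpos := hT'pos σ hσ.2
      have hN := P.indexSq_pos (h.u_mem hm hσ.2).1 (h.u_mem hm hσ.2).2
      rw [hspeed σ hσ.2, norm_smul, Real.norm_of_nonneg (by positivity), div_mul_eq_mul_div,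
        mul_div_assoc, mul_comm 2]
      gcongr)
  have hr : ∀ σ ∈ Set.Icc σ₁ σB, R / 2 ≤ ‖x σ‖ := fun σ hσ => by
    have h1 := hx σ hσ
    have h2 := (hT0 σ hσ).2
    have := norm_sub_norm_le (x σB) (x σ)
    rw [norm_sub_rev, hxB] at this
    linarith
  -- Per unit of coordinate time the change is at most `(1/N)(m/r²)|N'/2| ≤ 2 · 4m/R² · K`, acting
  -- for a time at most `R / 4`.
  have hmom : ∀ σ ∈ Set.Icc σ₁ σB, ‖p σ - p σB‖ ≤ 2 * K * m / R := fun σ hσ => by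
    have h1 := norm_sub_le_of_deriv_le (f := p) (g := fun σ => 8 * m * K / R ^ 2 * T σ)
      (g' := fun σ => 8 * m * K / R ^ 2 * (E / P.A (m / ‖x σ‖))) hσ.2
      (fun τ hτ => h.momentum τ hτ.2) (fun τ hτ => (h.time τ hτ.2).const_mul _)
      (fun τ hτ => by
        have hτ' : τ ∈ Set.Icc σ₁ σB := ⟨hσ.1.trans hτ.1, hτ.2⟩
        have hrτ := hr τ hτ'
        obtain ⟨-, hu⟩ := hfar τ hτ.2 hrτ
        obtain ⟨-, hG, -, hN2⟩ := hb _ (h.u_mem hm hτ.2).1 hu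
        have hr0 := h.norm_pos hm hτ.2
        have hT' := hT'pos τ hτ.2
        have hN0 : 0 < P.indexSq (m / ‖x τ‖) := by linarith
        have e1 : 1 / P.indexSq (m / ‖x τ‖) ≤ 2 := by
          rw [div_le_iff₀ hN0]; linarith
        have e2 : m / ‖x τ‖ ^ 2 ≤ m / (R / 2) ^ 2 := by gcongr
        rw [hspeed τ hτ.2, norm_smul, norm_neg, norm_mul, norm_mul,
          Real.norm_of_nonneg (by positivity), Real.norm_of_nonneg (by positivity),
          Real.norm_eq_abs]
        calc E / P.A (m / ‖x τ‖) / P.indexSq (m / ‖x τ‖) * (m / ‖x τ‖ ^ 3)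
              * |deriv P.indexSq (m / ‖x τ‖) / 2| * ‖x τ‖
            = E / P.A (m / ‖x τ‖) * (1 / P.indexSq (m / ‖x τ‖)) * (m / ‖x τ‖ ^ 2)
              * |deriv P.indexSq (m / ‖x τ‖) / 2| := by field_simp
          _ ≤ E / P.A (m / ‖x τ‖) * 2 * (m / (R / 2) ^ 2) * K := by gcongr
          _ = 8 * m * K / R ^ 2 * (E / P.A (m / ‖x τ‖)) := by field_simp; norm_num)
    have h2 := (hT0 σ hσ).2
    calc ‖p σ - p σB‖ ≤ 8 * m * K / R ^ 2 * (T σB - T σ) := by rw [mul_sub]; exact h1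
      _ ≤ 8 * m * K / R ^ 2 * (R / 4) := by gcongr
      _ = 2 * K * m / R := by field_simp; norm_num
  -- The velocity `p/N` differs from `p σB` by the drift of `p`, at most `2Km/R`, plus `|1/N - 1|
  -- ‖p‖`, at most `8Km/R`.
  have h3 := norm_sub_le_of_deriv_le (f := fun σ => x σ - T σ • p σB)
    (g := fun σ => 10 * m * K / R * T σ)
    (g' := fun σ => 10 * m * K / R * (E / P.A (m / ‖x σ‖))) hσ₁
    (fun τ hτ => (h.position τ hτ.2).sub ((h.time τ hτ.2).smul_const (p σB)))
    (fun τ hτ => (h.time τ hτ.2).const_mul _)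
    (fun τ hτ => by
      obtain ⟨hu', hu⟩ := hfar τ hτ.2 (hr τ hτ)
      obtain ⟨hN, -, -, hN2⟩ := hb _ (h.u_mem hm hτ.2).1 hu
      have hT' := hT'pos τ hτ.2
      have hN0 : 0 < P.indexSq (m / ‖x τ‖) := by linarith
      have e1 : |1 / P.indexSq (m / ‖x τ‖) - 1| ≤ 2 * (K * (2 * m / R)) := by
        have : 1 / P.indexSq (m / ‖x τ‖) - 1 =
            -(1 / P.indexSq (m / ‖x τ‖) * (P.indexSq (m / ‖x τ‖) - 1)) := by field_simp; ring
        rw [this, abs_neg, abs_mul, abs_of_pos (by positivity)]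
        have e2 : 1 / P.indexSq (m / ‖x τ‖) ≤ 2 := by
          rw [div_le_iff₀ hN0]; linarith
        have e3 : |P.indexSq (m / ‖x τ‖) - 1| ≤ K * (2 * m / R) := hN.trans (by gcongr)
        gcongr
      have e4 : (E * P.B (m / ‖x τ‖)) • p τ - (E / P.A (m / ‖x τ‖)) • p σB =
          (E / P.A (m / ‖x τ‖)) • ((p τ - p σB) + (1 / P.indexSq (m / ‖x τ‖) - 1) • p τ) := by
        rw [hspeed τ hτ.2]
        module
      rw [e4, norm_smul, Real.norm_of_nonneg hT'.le, mul_comm]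
      gcongr
      calc ‖(p τ - p σB) + (1 / P.indexSq (m / ‖x τ‖) - 1) • p τ‖
          ≤ ‖p τ - p σB‖ + |1 / P.indexSq (m / ‖x τ‖) - 1| * ‖p τ‖ := by
            refine (norm_add_le _ _).trans ?_
            rw [norm_smul, Real.norm_eq_abs]
        _ ≤ 2 * K * m / R + 2 * (K * (2 * m / R)) * 2 := by
            gcongr
            · exact hmom τ hτ
            · exact (hp2 τ hτ.2 hu).1
        _ = 10 * m * K / R := by ring)
  have h4 := (hT0 σ₁ ⟨le_rfl, hσ₁⟩).2
  have e5 : (x σB - x σ₁) - (T σB - T σ₁) • p σB =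
      -((x σ₁ - T σ₁ • p σB) - (x σB - T σB • p σB)) := by module
  rw [e5, norm_neg]
  calc _ ≤ 10 * m * K / R * (T σB - T σ₁) := by rw [mul_sub]; exact h3
    _ ≤ 10 * m * K / R * (R / 4) := by gcongr
    _ = 5 / 2 * (K * m) := by field_simp; norm_num
    _ ≤ 3 * K * m := by nlinarith [mul_pos (by linarith : 0 < K) hm]

end IsReducedRay

namespace IsQuasiMinkowskianFromInfinity

variable {P : Potentials β γ ε} {Ne xB : Triple} {x0B σB m₀ : ℝ} {Γ : ℝ → ℝ → Event}

theorem space_end (h : IsQuasiMinkowskianFromInfinity P Ne xB x0B σB m₀ Γ) {m : ℝ} (h0 : 0 < m)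
    (hm : m < m₀) : (Γ m σB).space = xB := by
  obtain ⟨X0, X, -, hX, hs⟩ := h.expansion
  have h1 := (hs m h0 hm σB le_rfl).2
  simp only [hX, smul_zero, sub_self, zero_smul, add_zero] at h1
  exact sub_eq_zero.1 (h1.unique hasSum_zero)

theorem time_end (h : IsQuasiMinkowskianFromInfinity P Ne xB x0B σB m₀ Γ) {m : ℝ} (h0 : 0 < m)
    (hm : m < m₀) : Γ m σB 0 = x0B := by
  obtain ⟨X0, X, hX, -, hs⟩ := h.expansion
  have h1 := (hs m h0 hm σB le_rfl).1
  simp only [hX, mul_zero, sub_self, add_zero] at h1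
  exact sub_eq_zero.1 (h1.unique hasSum_zero)

theorem tendsto_time (h : IsQuasiMinkowskianFromInfinity P Ne xB x0B σB m₀ Γ) (hm₀ : 0 < m₀)
    {σ : ℝ} (hσ : σ ≤ σB) :
    Tendsto (fun m => Γ m σ 0 - (x0B + (σ - σB))) (𝓝[>] 0) (𝓝 0) := by
  obtain ⟨X0, X, -, -, hs⟩ := h.expansion
  exact tendsto_zero_of_hasSum_pow_succ (c := fun n => X0 n σ) hm₀
    fun m h0 hm => (hs m h0 hm σ hσ).1

theorem tendsto_space (h : IsQuasiMinkowskianFromInfinity P Ne xB x0B σB m₀ Γ) (hm₀ : 0 < m₀)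
    {σ : ℝ} (hσ : σ ≤ σB) :
    Tendsto (fun m => (Γ m σ).space - (xB + (σ - σB) • Ne)) (𝓝[>] 0) (𝓝 0) := by
  obtain ⟨X0, X, -, -, hs⟩ := h.expansion
  exact tendsto_zero_of_hasSum_pow_succ (c := fun n => X n σ) hm₀
    fun m h0 hm => (hs m h0 hm σ hσ).2

/-- The direction at reception of a quasi-Minkowskian ray tends to the unperturbed one. -/
theorem eventually_direction_near (h : IsQuasiMinkowskianFromInfinity P Ne xB x0B σB m₀ Γ)
    (hm₀ : 0 < m₀) (hxB : xB ≠ 0) (hNe : ‖Ne‖ = 1) {η : ℝ} (hη : 0 < η) :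
    ∀ᶠ m in 𝓝[>] (0 : ℝ), ∀ (E : ℝ) (p : ℝ → Triple), E ≠ 0 →
      IsReducedRay P m E σB (fun σ => Γ m σ 0) (fun σ => (Γ m σ).space) p →
      0 < E ∧ ‖p σB - Ne‖ < η := by
  obtain ⟨u₁, K, hu₁, -, hK, hb⟩ := P.exists_weak_field_bounds
  set R := ‖xB‖ with hRdef
  have hR : 0 < R := norm_pos_iff.2 hxB
  -- With an error below `R / 16` the elapsed coordinate time lies between `R / 16` and `3R / 16`:
  -- long enough to divide by, and within the `R / 4` allowed for a nearly straight piece.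
  set σ₁ := σB - R / 8 with hσ₁
  have hle : σ₁ ≤ σB := by linarith
  have hT := (h.tendsto_time hm₀ hle).abs
  have hX := (h.tendsto_space hm₀ hle).norm
  rw [abs_zero] at hT
  rw [norm_zero] at hX
  have hmt : Tendsto (fun m : ℝ => m) (𝓝[>] 0) (𝓝 0) := tendsto_id.mono_left nhdsWithin_le_nhds
  have hsum : Tendsto (fun m => 16 / R * (3 * K * m + ‖(Γ m σ₁).space - (xB + (σ₁ - σB) • Ne)‖
      + |Γ m σ₁ 0 - (x0B + (σ₁ - σB))|)) (𝓝[>] 0) (𝓝 0) := by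
    have := (((hmt.const_mul (3 * K)).add hX).add hT).const_mul (16 / R)
    simpa using this
  filter_upwards [hsum.eventually (gt_mem_nhds hη), Ioo_mem_nhdsGT hm₀,
    hT.eventually (gt_mem_nhds (by positivity : 0 < R / 16)),
    Ioo_mem_nhdsGT (by positivity : 0 < u₁ * (R / 2))] with m hs hm hT1 hmu E p hE0 hray
  have hTB : Γ m σB 0 = x0B := h.time_end hm.1 hm.2
  have hXB : (Γ m σB).space = xB := h.space_end hm.1 hm.2
  have hΔ := abs_lt.1 hT1
  have hΔ1 : R / 16 < Γ m σB 0 - Γ m σ₁ 0 := by rw [hTB]; linarith [hΔ.2]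
  have hΔ2 : Γ m σB 0 - Γ m σ₁ 0 ≤ R / 4 := by rw [hTB]; linarith [hΔ.1]
  have hE : 0 < E := by
    have := hray.sub_time_mul_energy_nonneg hm.1 hle le_rfl
    have h2 := nonneg_of_mul_nonneg_left this (by linarith)
    exact lt_of_le_of_ne h2 hE0.symm
  refine ⟨hE, ?_⟩
  have hmR : m / (R / 2) < u₁ := by
    rw [div_lt_iff₀ (by positivity)]; exact hmu.2
  have key := hray.norm_displacement_sub_le hm.1 hE hK
    (fun u h0 h1 => ⟨(hb u h0 h1).2.1, (hb u h0 h1).2.2.1, (hb u h0 h1).2.2.2.2⟩) hR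
    (by rw [hXB]) hmR hle hΔ2
  simp only [hXB] at key
  set Δ := Γ m σB 0 - Γ m σ₁ 0 with hΔdef
  have hΔ0 : 0 < Δ := lt_trans (by positivity) hΔ1
  -- The chord is compared with `Δ • p σB` by near-straightness, and with its unperturbed value by
  -- the expansion at the fixed parameter `σ₁`.
  have e1 : Δ • (p σB - Ne) = -((xB - (Γ m σ₁).space) - Δ • p σB)
      - ((Γ m σ₁).space - (xB + (σ₁ - σB) • Ne)) + (Γ m σ₁ 0 - (x0B + (σ₁ - σB))) • Ne := by
    rw [hΔdef, hTB]; module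
  have e2 : Δ * ‖p σB - Ne‖ ≤ 3 * K * m + ‖(Γ m σ₁).space - (xB + (σ₁ - σB) • Ne)‖
      + |Γ m σ₁ 0 - (x0B + (σ₁ - σB))| := by
    rw [← Real.norm_of_nonneg hΔ0.le, ← norm_smul, e1]
    refine (norm_add_le _ _).trans ?_
    rw [norm_smul, hNe, mul_one, Real.norm_eq_abs]
    gcongr
    refine (norm_sub_le _ _).trans ?_
    rw [norm_neg]
    gcongr
  refine lt_of_le_of_lt ?_ hs
  rw [div_mul_eq_mul_div, le_div_iff₀ hR]
  nlinarith [norm_nonneg (p σB - Ne)]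

end IsQuasiMinkowskianFromInfinity

/-! ### Second-order deflection of a planar ray -/

theorem eq_of_hasDerivWithinAt_zero_Iic {f : ℝ → ℝ} {b : ℝ}
    (hf : ∀ σ ≤ b, HasDerivWithinAt f 0 (Set.Iic b) σ) {σ : ℝ} (hσ : σ ≤ b) : f σ = f b := by
  have h := (convex_Iic b).norm_image_sub_le_of_norm_hasDerivWithin_le (f := f) (f' := fun _ => 0)
    (C := 0) (fun τ hτ => hf τ hτ) (fun τ _ => by simp) (Set.mem_Iic.2 hσ) (Set.mem_Iic.2 le_rfl)
  rw [zero_mul] at h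
  exact (sub_eq_zero.1 (norm_le_zero_iff.1 h)).symm

/-- A planar motion under a central force which is, up to higher order, the sum of an inverse-square
and an inverse-cube one; the motion comes from infinity in the direction of the first axis. -/
structure IsPlanarRay (m b σB a k K : ℝ) (X Y P Q w G r : ℝ → ℝ) : Prop where
  m_pos : 0 < m
  b_pos : 0 < b
  r_pos : ∀ σ ≤ σB, 0 < r σ
  r_sq : ∀ σ ≤ σB, X σ ^ 2 + Y σ ^ 2 = r σ ^ 2
  derivX : ∀ σ ≤ σB, HasDerivWithinAt X (w σ * P σ) (Set.Iic σB) σ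
  derivY : ∀ σ ≤ σB, HasDerivWithinAt Y (w σ * Q σ) (Set.Iic σB) σ
  derivP : ∀ σ ≤ σB, HasDerivWithinAt P (-(w σ * (m / r σ ^ 3) * G σ) * X σ) (Set.Iic σB) σ
  derivQ : ∀ σ ≤ σB, HasDerivWithinAt Q (-(w σ * (m / r σ ^ 3) * G σ) * Y σ) (Set.Iic σB) σ
  continuousOn_w : ContinuousOn w (Set.Iic σB)
  exists_lt_w : ∃ w₀ > 0, ∀ σ ≤ σB, w₀ ≤ w σ
  angularMomentum : ∀ σ ≤ σB, Y σ * P σ - X σ * Q σ = b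
  abs_G_le : ∀ σ ≤ σB, |G σ| ≤ K
  abs_G_sub_le : ∀ σ ≤ σB, |G σ - (a + 2 * k * (m / r σ))| ≤ K * (m / r σ) ^ 2
  tendstoP : Tendsto P atBot (𝓝 1)
  tendstoQ : Tendsto Q atBot (𝓝 0)

namespace IsPlanarRay

variable {m b σB a k K : ℝ} {X Y P Q w G r : ℝ → ℝ}

/-- The polar angle, counted from the direction of emission. -/
theorem exists_angle (h : IsPlanarRay m b σB a k K X Y P Q w G r) {θB : ℝ}
    (hXB : X σB = -(r σB * Real.cos θB)) (hYB : Y σB = r σB * Real.sin θB) :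
    ∃ θ g : ℝ → ℝ, (∀ σ, HasDerivAt θ (g σ) σ) ∧ (∀ σ, 0 ≤ g σ) ∧ θ σB = θB ∧
      ∀ σ ≤ σB, g σ = w σ * b / r σ ^ 2 ∧
        X σ = -(r σ * Real.cos (θ σ)) ∧ Y σ = r σ * Real.sin (θ σ) := by
  have hr' : ∀ σ ≤ σB, r σ = Real.sqrt (X σ ^ 2 + Y σ ^ 2) := fun σ hσ => by
    rw [h.r_sq σ hσ, Real.sqrt_sq (h.r_pos σ hσ).le]
  have hdr : ∀ σ ≤ σB, HasDerivWithinAt r ((X σ * (w σ * P σ) + Y σ * (w σ * Q σ)) / r σ)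
      (Set.Iic σB) σ := fun σ hσ => by
    have h1 := (((h.derivX σ hσ).pow 2).add ((h.derivY σ hσ).pow 2)).sqrt
      (by
        have := h.r_pos σ hσ
        have h2 := h.r_sq σ hσ
        simp only [Pi.add_apply, Pi.pow_apply]
        rw [h2]; positivity)
    have h3 : HasDerivWithinAt r _ (Set.Iic σB) σ := h1.congr (fun τ hτ => hr' τ hτ) (hr' σ hσ)
    refine h3.congr_deriv ?_
    simp only [Pi.add_apply, Pi.pow_apply]
    rw [← hr' σ hσ]
    have := (h.r_pos σ hσ).ne'
    field_simp
    push_cast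
    ring
  obtain ⟨w₀, hw₀, hw⟩ := h.exists_lt_w
  have hcr : ContinuousOn r (Set.Iic σB) := fun σ hσ => (hdr σ hσ).continuousWithinAt
  -- The angular velocity `w b / r²`, frozen beyond `σB` so that it is continuous on the whole line
  -- and its integral is differentiable everywhere.
  set g : ℝ → ℝ := fun σ => w (min σ σB) * b / r (min σ σB) ^ 2 with hg
  have hgc : Continuous g := by
    have h0 : ContinuousOn (fun σ => w σ * b / r σ ^ 2) (Set.Iic σB) :=
      (h.continuousOn_w.mul continuousOn_const).div (hcr.pow 2)
        (fun σ hσ => (pow_pos (h.r_pos σ hσ) 2).ne')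
    have := h0.comp_continuous (f := fun σ => min σ σB) (by fun_prop)
      (fun σ => Set.mem_Iic.2 (min_le_right _ _))
    exact this
  set θ : ℝ → ℝ := fun σ => θB + ∫ t in σB..σ, g t with hθ
  have hdθ : ∀ σ, HasDerivAt θ (g σ) σ := fun σ =>
    (intervalIntegral.integral_hasDerivAt_right (hgc.intervalIntegrable _ _)
      (hgc.stronglyMeasurableAtFilter _ _) hgc.continuousAt).const_add θB
  have hg' : ∀ σ ≤ σB, g σ = w σ * b / r σ ^ 2 := fun σ hσ => by
    simp only [hg, min_eq_left hσ]
  have hθB : θ σB = θB := by simp [hθ]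
  -- The unit position vector, rotated back by the integrated angle, has zero derivative and so
  -- keeps its value at `σB`. This avoids choosing a branch of the argument.
  have hc1 : ∀ σ ≤ σB, (X σ * Real.cos (θ σ) - Y σ * Real.sin (θ σ)) / r σ = -1 := fun σ hσ => by
    rw [eq_of_hasDerivWithinAt_zero_Iic
      (f := fun σ => (X σ * Real.cos (θ σ) - Y σ * Real.sin (θ σ)) / r σ) (fun τ hτ => ?_) hσ]
    · have := (h.r_pos σB le_rfl).ne'
      have hcs := Real.sin_sq_add_cos_sq θB
      rw [hθB, hXB, hYB]
      field_simp
      linarith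
    · have hr0 := (h.r_pos τ hτ).ne'
      refine ((((h.derivX τ hτ).mul (hdθ τ).cos.hasDerivWithinAt).sub
        ((h.derivY τ hτ).mul (hdθ τ).sin.hasDerivWithinAt)).div (hdr τ hτ) hr0).congr_deriv ?_
      rw [hg' τ hτ, div_eq_zero_iff]
      left
      simp only [Pi.sub_apply, Pi.mul_apply]
      have hrs := h.r_sq τ hτ
      have hL := h.angularMomentum τ hτ
      field_simp
      rw [← hL, ← hrs]
      ring
  have hc2 : ∀ σ ≤ σB, (X σ * Real.sin (θ σ) + Y σ * Real.cos (θ σ)) / r σ = 0 := fun σ hσ => by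
    rw [eq_of_hasDerivWithinAt_zero_Iic
      (f := fun σ => (X σ * Real.sin (θ σ) + Y σ * Real.cos (θ σ)) / r σ) (fun τ hτ => ?_) hσ]
    · rw [hθB, hXB, hYB]
      ring
    · have hr0 := (h.r_pos τ hτ).ne'
      refine ((((h.derivX τ hτ).mul (hdθ τ).sin.hasDerivWithinAt).add
        ((h.derivY τ hτ).mul (hdθ τ).cos.hasDerivWithinAt)).div (hdr τ hτ) hr0).congr_deriv ?_
      rw [hg' τ hτ, div_eq_zero_iff]
      left
      simp only [Pi.add_apply, Pi.mul_apply]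
      have hrs := h.r_sq τ hτ
      have hL := h.angularMomentum τ hτ
      field_simp
      rw [← hL, ← hrs]
      ring
  refine ⟨θ, g, hdθ, fun σ => ?_, hθB, fun σ hσ => ⟨hg' σ hσ, ?_, ?_⟩⟩
  · have := hw _ (min_le_right σ σB)
    have := h.b_pos
    simp only [hg]
    have : 0 ≤ w (min σ σB) := by linarith
    positivity
  · have h1 := hc1 σ hσ
    have h2 := hc2 σ hσ
    have hr0 := (h.r_pos σ hσ).ne'
    rw [div_eq_iff hr0] at h1 h2
    have hcs := Real.sin_sq_add_cos_sq (θ σ)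
    linear_combination Real.cos (θ σ) * h1 + Real.sin (θ σ) * h2 - X σ * hcs
  · have h1 := hc1 σ hσ
    have h2 := hc2 σ hσ
    have hr0 := (h.r_pos σ hσ).ne'
    rw [div_eq_iff hr0] at h1 h2
    have hcs := Real.sin_sq_add_cos_sq (θ σ)
    linear_combination -Real.sin (θ σ) * h1 + Real.cos (θ σ) * h2 - Y σ * hcs

/-- Second-order deflection of a ray that comes from infinity. -/
theorem abs_direction_sub_le (h : IsPlanarRay m b σB a k K X Y P Q w G r) {c s : ℝ}
    (hcs : c ^ 2 + s ^ 2 = 1) (hs : 0 < s) (hXB : X σB = r σB * c) (hYB : Y σB = r σB * s)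
    (hPB : |P σB - 1| ≤ 1 / 4) (hsmall : m / b * K ≤ 1 / 8) :
    |P σB - (1 + m / b * a * s + (m / b) ^ 2 * k * s ^ 2)| ≤ (16 * K + 64 * |k| * K) * (m / b) ^ 3 ∧
    |Q σB + (m / b * a * (1 + c) + (m / b) ^ 2 * k * (Real.pi - Real.arccos c + s * c))| ≤
      (16 * K + 64 * |k| * K) * (m / b) ^ 3 := by
  have hm := h.m_pos
  have hb := h.b_pos
  set e := m / b with he
  have he0 : 0 < e := div_pos hm hb
  have hK : 0 ≤ K := (abs_nonneg _).trans (h.abs_G_le σB le_rfl)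
  have hc1 : -1 < c := by nlinarith
  have hc2 : c < 1 := by nlinarith
  have hcos : Real.cos (Real.pi - Real.arccos c) = -c := by
    rw [Real.cos_pi_sub, Real.cos_arccos hc1.le hc2.le]
  have hsin : Real.sin (Real.pi - Real.arccos c) = s := by
    rw [Real.sin_pi_sub, Real.sin_arccos, show 1 - c ^ 2 = s ^ 2 by linarith, Real.sqrt_sq hs.le]
  have hac0 : 0 < Real.arccos c := Real.arccos_pos.2 hc2
  have hac1 : Real.arccos c < Real.pi := by
    have := Real.arccos_lt_arccos (x := -1) (y := c) le_rfl hc1 hc2.le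
    rwa [Real.arccos_neg_one] at this
  have hπ := Real.pi_lt_d2
  have hπ3 := Real.pi_gt_three
  obtain ⟨θ, g, hdθ, hg0, hθB, hθ⟩ := h.exists_angle (θB := Real.pi - Real.arccos c)
    (by rw [hcos, hXB]; ring) (by rw [hsin, hYB])
  set θB := Real.pi - Real.arccos c with hθBdef
  have hmono : Monotone θ := monotone_of_deriv_nonneg (fun σ => (hdθ σ).differentiableAt)
    (fun σ => by rw [(hdθ σ).deriv]; exact hg0 σ)
  -- The exact orbit equation: angular momentum divided by `r`, in polar form.
  have hq : ∀ σ ≤ σB, b / r σ = P σ * Real.sin (θ σ) + Q σ * Real.cos (θ σ) := fun σ hσ => by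
    have hr := (h.r_pos σ hσ).ne'
    obtain ⟨-, hx, hy⟩ := hθ σ hσ
    rw [div_eq_iff hr, ← h.angularMomentum σ hσ, hx, hy]
    ring
  have hqpos : ∀ σ ≤ σB, 0 < b / r σ := fun σ hσ => div_pos hb (h.r_pos σ hσ)
  have hdP : ∀ σ ≤ σB, HasDerivWithinAt P (e * G σ * Real.cos (θ σ) * g σ) (Set.Iic σB) σ :=
    fun σ hσ => by
      refine (h.derivP σ hσ).congr_deriv ?_
      obtain ⟨hg, hx, -⟩ := hθ σ hσ
      have hr := (h.r_pos σ hσ).ne'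
      rw [hg, hx, he]
      field_simp
  have hdQ : ∀ σ ≤ σB, HasDerivWithinAt Q (-(e * G σ * Real.sin (θ σ) * g σ)) (Set.Iic σB) σ :=
    fun σ hσ => by
      refine (h.derivQ σ hσ).congr_deriv ?_
      obtain ⟨hg, -, hy⟩ := hθ σ hσ
      have hr := (h.r_pos σ hσ).ne'
      rw [hg, hy, he]
      field_simp
  have hbd : ∀ σ ≤ σB, ∀ t : ℝ, |t| ≤ 1 → |e * G σ * t * g σ| ≤ e * K * g σ := fun σ hσ t ht => by
    rw [abs_mul, abs_mul, abs_mul, abs_of_pos he0, abs_of_nonneg (hg0 σ)]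
    have : |G σ| * |t| ≤ K * 1 := mul_le_mul (h.abs_G_le σ hσ) ht (abs_nonneg _) hK
    rw [mul_assoc e]
    have := hg0 σ
    gcongr
    linarith
  have hvarP : ∀ σ' σ, σ' ≤ σ → σ ≤ σB → |P σ' - P σ| ≤ e * K * (θ σ - θ σ') := fun σ' σ h1 h2 => by
    rw [mul_sub]
    exact norm_sub_le_of_deriv_le (f := P) (g := fun τ => e * K * θ τ) h1
      (fun τ hτ => (hdP τ (hτ.2.trans h2)).mono (Set.Iic_subset_Iic.2 h2))
      (fun τ hτ => ((hdθ τ).const_mul _).hasDerivWithinAt)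
      (fun τ hτ => hbd τ (hτ.2.trans h2) _ (Real.abs_cos_le_one _))
  have hvarQ : ∀ σ' σ, σ' ≤ σ → σ ≤ σB → |Q σ' - Q σ| ≤ e * K * (θ σ - θ σ') := fun σ' σ h1 h2 => by
    rw [mul_sub]
    exact norm_sub_le_of_deriv_le (f := Q) (g := fun τ => e * K * θ τ) h1
      (fun τ hτ => (hdQ τ (hτ.2.trans h2)).mono (Set.Iic_subset_Iic.2 h2))
      (fun τ hτ => ((hdθ τ).const_mul _).hasDerivWithinAt)
      (fun τ hτ => by
        rw [norm_neg]; exact hbd τ (hτ.2.trans h2) _ (Real.abs_sin_le_one _))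
  -- While `θ ≥ -π/2` the swept angle is below `3π/2`, so `P` moves from its final value, at least
  -- `3/4`, by at most `3π/16 < 0.6`.
  have hPlow : ∀ σ ≤ σB, -(Real.pi / 2) ≤ θ σ → 1 / 8 ≤ P σ := fun σ hσ hlow => by
    have h1 := hvarP σ σB hσ le_rfl
    rw [hθB] at h1
    have h2 : e * K * (θB - θ σ) ≤ 1 / 8 * (θB - θ σ) := by
      have : θ σ ≤ θB := hθB ▸ hmono hσ
      gcongr
    have h3 := (abs_le.1 (h1.trans h2)).1
    have h4 := (abs_le.1 hPB).1
    linarith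
  -- At `θ = -π/2` the orbit equation reads `b/r = -P`, which is negative: the ray cannot wind
  -- around the centre.
  have hlow : ∀ σ ≤ σB, -(Real.pi / 2) < θ σ := fun σ hσ => by
    by_contra hcon
    push Not at hcon
    have hcont : ContinuousOn θ (Set.Icc σ σB) := fun τ _ =>
      (hdθ τ).continuousAt.continuousWithinAt
    obtain ⟨τ, hτ, hτe⟩ := intermediate_value_Icc hσ hcont
      (show -(Real.pi / 2) ∈ Set.Icc (θ σ) (θ σB) from ⟨hcon, by rw [hθB]; linarith⟩)
    have h1 := hqpos τ hτ.2
    rw [hq τ hτ.2, hτe, Real.sin_neg, Real.cos_neg, Real.sin_pi_div_two, Real.cos_pi_div_two] at h1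
    have h2 := hPlow τ hτ.2 hτe.ge
    linarith
  have hqlim : Tendsto (fun σ => b / r σ) atBot (𝓝 0) := by
    obtain ⟨w₀, hw₀, hw⟩ := h.exists_lt_w
    have hX : ∀ σ ≤ σB, X σ ≤ X σB - w₀ / 8 * (σB - σ) := fun σ hσ => by
      have := norm_sub_le_of_deriv_le (V := ℝ) (f := fun _ => 0) (f' := fun _ => 0)
        (g := fun τ => X τ - w₀ / 8 * τ) (g' := fun τ => w τ * P τ - w₀ / 8 * 1) hσ
        (fun τ _ => hasDerivWithinAt_const _ _ _)
        (fun τ hτ => (h.derivX τ hτ.2).sub ((hasDerivWithinAt_id _ _).const_mul _))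
        (fun τ hτ => by
          have h1 := hPlow τ hτ.2 (hlow τ hτ.2).le
          have h2 := hw τ hτ.2
          rw [norm_zero]
          nlinarith)
      simp only [sub_zero, norm_zero] at this
      linarith
    have hr : Tendsto r atBot atTop := by
      refine tendsto_atTop_mono' _ (f₁ := fun σ => -X σB + w₀ / 8 * (σB - σ)) ?_ ?_
      · filter_upwards [eventually_le_atBot σB] with σ hσ
        have h1 := hX σ hσ
        have h2 := h.r_sq σ hσ
        have h3 := abs_le_of_sq_le_sq (a := X σ) (b := r σ) (by nlinarith [sq_nonneg (Y σ)])
          (h.r_pos σ hσ).le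
        linarith [(abs_le.1 h3).1]
      · refine tendsto_atTop_add_const_left _ _ (Tendsto.const_mul_atTop (by positivity) ?_)
        exact tendsto_atTop_add_const_left _ _ tendsto_neg_atBot_atTop
    exact hr.const_div_atTop b
  have hbdd : BddBelow (Set.range θ) := ⟨-(Real.pi / 2), by
    rintro _ ⟨σ, rfl⟩
    rcases le_total σ σB with hσ | hσ
    · exact (hlow σ hσ).le
    · exact (hlow σB le_rfl).le.trans (hmono hσ)⟩
  have hlim := tendsto_atBot_ciInf hmono hbdd
  set L := ⨅ σ, θ σ with hL
  -- As `r → ∞`, `P → 1` and `Q → 0`, the orbit equation forces `sin L = 0`, and `-π/2 ≤ L < π`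
  -- leaves only `0`.
  have hL0 : L = 0 := by
    have h1 : -(Real.pi / 2) ≤ L := le_ciInf fun σ => by
      rcases le_total σ σB with hσ | hσ
      · exact (hlow σ hσ).le
      · exact (hlow σB le_rfl).le.trans (hmono hσ)
    have h2 : L ≤ θB := hθB ▸ ciInf_le hbdd σB
    have h3 : Tendsto (fun σ => P σ * Real.sin (θ σ) + Q σ * Real.cos (θ σ)) atBot
        (𝓝 (1 * Real.sin L + 0 * Real.cos L)) :=
      (h.tendstoP.mul ((Real.continuous_sin.tendsto _).comp hlim)).add
        (h.tendstoQ.mul ((Real.continuous_cos.tendsto _).comp hlim))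
    have h4 := tendsto_nhds_unique (h3.congr' (by
      filter_upwards [eventually_le_atBot σB] with σ hσ using (hq σ hσ).symm)) hqlim
    refine (Real.sin_eq_zero_iff_of_lt_of_lt (by linarith) (by linarith)).1 (by linarith)
  rw [hL0] at hlim
  have hθ0 : ∀ σ, 0 ≤ θ σ := fun σ => hL0 ▸ ciInf_le hbdd σ
  -- First integration from infinity; the factor `4` bounds the total angle `θB < π`.
  have hP1 : ∀ σ ≤ σB, |P σ - 1| ≤ e * K * 4 := fun σ hσ => by
    have h1 : |1 - P σ| ≤ e * K * (θ σ - 0) := le_of_tendsto_of_tendsto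
      ((h.tendstoP.sub_const _).abs) ((hlim.const_sub _).const_mul _) (by
        filter_upwards [eventually_le_atBot σ] with σ' hσ' using hvarP σ' σ hσ' hσ)
    rw [abs_sub_comm]
    refine h1.trans ?_
    have : θ σ ≤ θB := hθB ▸ hmono hσ
    gcongr
    linarith
  have hQ1 : ∀ σ ≤ σB, |Q σ| ≤ e * K * 4 := fun σ hσ => by
    have h1 : |0 - Q σ| ≤ e * K * (θ σ - 0) := le_of_tendsto_of_tendsto
      ((h.tendstoQ.sub_const _).abs) ((hlim.const_sub _).const_mul _) (by
        filter_upwards [eventually_le_atBot σ] with σ' hσ' using hvarQ σ' σ hσ' hσ)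
    rw [zero_sub, abs_neg] at h1
    refine h1.trans ?_
    have : θ σ ≤ θB := hθB ▸ hmono hσ
    gcongr
    linarith
  have hqs : ∀ σ ≤ σB, |b / r σ - Real.sin (θ σ)| ≤ 8 * (e * K) := fun σ hσ => by
    rw [hq σ hσ, show P σ * Real.sin (θ σ) + Q σ * Real.cos (θ σ) - Real.sin (θ σ) =
      (P σ - 1) * Real.sin (θ σ) + Q σ * Real.cos (θ σ) by ring]
    refine (abs_add_le _ _).trans ?_
    rw [abs_mul, abs_mul]
    have h1 : |P σ - 1| * |Real.sin (θ σ)| ≤ e * K * 4 * 1 :=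
      mul_le_mul (hP1 σ hσ) (Real.abs_sin_le_one _) (abs_nonneg _) (by positivity)
    have h2 : |Q σ| * |Real.cos (θ σ)| ≤ e * K * 4 * 1 :=
      mul_le_mul (hQ1 σ hσ) (Real.abs_cos_le_one _) (abs_nonneg _) (by positivity)
    linarith
  -- Since `m/r = e (b/r)`, the first-order orbit `b/r ≈ sin θ` already determines `G` up to
  -- `O(e²)`, and `P`, `Q` up to `O(e³)`.
  have hGerr : ∀ σ ≤ σB, |G σ - (a + 2 * k * e * Real.sin (θ σ))| ≤
      e ^ 2 * (4 * K + 16 * |k| * K) := fun σ hσ => by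
    have hu : m / r σ = e * (b / r σ) := by
      rw [he]; field_simp
    have h1 := h.abs_G_sub_le σ hσ
    rw [hu] at h1
    have h2 := hqs σ hσ
    have h3 : b / r σ ≤ 2 := by
      have := (abs_le.1 h2).2
      have := Real.sin_le_one (θ σ)
      linarith
    have h4 : (b / r σ) ^ 2 ≤ 4 := by
      have := hqpos σ hσ
      nlinarith
    have h5 : G σ - (a + 2 * k * e * Real.sin (θ σ)) =
        (G σ - (a + 2 * k * (e * (b / r σ)))) + 2 * e * (k * (b / r σ - Real.sin (θ σ))) := by ring
    rw [h5]
    refine (abs_add_le _ _).trans ?_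
    rw [abs_mul (2 * e), abs_mul k, abs_of_pos (by positivity : 0 < 2 * e)]
    calc _ ≤ K * (e * (b / r σ)) ^ 2 + 2 * e * (|k| * (8 * (e * K))) := by gcongr
      _ = K * e ^ 2 * (b / r σ) ^ 2 + 2 * e * (|k| * (8 * (e * K))) := by ring
      _ ≤ K * e ^ 2 * 4 + 2 * e * (|k| * (8 * (e * K))) := by gcongr
      _ = _ := by ring
  set D := e ^ 3 * (4 * K + 16 * |k| * K) with hD
  have hD0 : 0 ≤ D := by positivity
  have hbd' : ∀ σ ≤ σB, ∀ t : ℝ, |t| ≤ 1 →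
      |e * (G σ - (a + 2 * k * e * Real.sin (θ σ))) * t * g σ| ≤ D * g σ := fun σ hσ t ht => by
    rw [abs_mul, abs_mul, abs_mul, abs_of_pos he0, abs_of_nonneg (hg0 σ)]
    have : |G σ - (a + 2 * k * e * Real.sin (θ σ))| * |t| ≤ e ^ 2 * (4 * K + 16 * |k| * K) * 1 :=
      mul_le_mul (hGerr σ hσ) ht (abs_nonneg _) (by positivity)
    rw [mul_assoc e]
    have := hg0 σ
    gcongr
    rw [hD]
    calc _ ≤ e * (e ^ 2 * (4 * K + 16 * |k| * K) * 1) := by gcongr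
      _ = _ := by ring
  have hfin : D * θB ≤ (16 * K + 64 * |k| * K) * e ^ 3 := by
    calc D * θB ≤ D * 4 := by gcongr; linarith
      _ = _ := by rw [hD]; ring
  have hsinlim := (Real.continuous_sin.tendsto _).comp hlim
  have hcoslim := (Real.continuous_cos.tendsto _).comp hlim
  rw [Real.sin_zero] at hsinlim
  rw [Real.cos_zero] at hcoslim
  constructor
  -- The subtracted function is the primitive in `θ` of `e (a + 2ke sin θ) cos θ`, so `F` varies
  -- only by the error in `G`; the other component is treated in the same way.
  · set F : ℝ → ℝ := fun σ => P σ - (e * a * Real.sin (θ σ) + e ^ 2 * k * Real.sin (θ σ) ^ 2) with hF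
    have hFlim : Tendsto F atBot (𝓝 1) := by
      have := h.tendstoP.sub ((hsinlim.const_mul (e * a)).add
        ((hsinlim.pow 2).const_mul (e ^ 2 * k)))
      simpa using this
    have hvar : ∀ σ ≤ σB, |F σ - F σB| ≤ D * θ σB - D * θ σ := fun σ hσ =>
      norm_sub_le_of_deriv_le (f := F) (g := fun τ => D * θ τ) hσ
        (fun τ hτ => (hdP τ hτ.2).sub (((hdθ τ).sin.hasDerivWithinAt.const_mul (e * a)).add
          (((hdθ τ).sin.hasDerivWithinAt.pow 2).const_mul (e ^ 2 * k))))
        (fun τ hτ => ((hdθ τ).const_mul _).hasDerivWithinAt)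
        (fun τ hτ => by
          refine le_of_eq_of_le ?_ (hbd' τ hτ.2 _ (Real.abs_cos_le_one (θ τ)))
          rw [Real.norm_eq_abs]
          congr 1
          push_cast
          ring)
    have h1 : |1 - F σB| ≤ D * θ σB - D * 0 := le_of_tendsto_of_tendsto
      ((hFlim.sub_const _).abs) ((hlim.const_mul _).const_sub _) (by
        filter_upwards [eventually_le_atBot σB] with σ' hσ' using hvar σ' hσ')
    simp only [hF] at h1
    rw [hθB, hsin, mul_zero, sub_zero] at h1
    rw [abs_sub_comm]
    refine le_trans (le_of_eq ?_) (h1.trans hfin)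
    congr 1
    ring
  · set F : ℝ → ℝ := fun σ => Q σ + (e * a * (1 - Real.cos (θ σ)) +
      e ^ 2 * k * (θ σ - Real.sin (θ σ) * Real.cos (θ σ))) with hF
    have hFlim : Tendsto F atBot (𝓝 0) := by
      have := h.tendstoQ.add (((hcoslim.const_sub 1).const_mul (e * a)).add
        ((hlim.sub (hsinlim.mul hcoslim)).const_mul (e ^ 2 * k)))
      simpa using this
    have hvar : ∀ σ ≤ σB, |F σ - F σB| ≤ D * θ σB - D * θ σ := fun σ hσ =>
      norm_sub_le_of_deriv_le (f := F) (g := fun τ => D * θ τ) hσ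
        (fun τ hτ => (hdQ τ hτ.2).add
          (((hdθ τ).cos.hasDerivWithinAt.const_sub 1).const_mul (e * a) |>.add
          (((hdθ τ).hasDerivWithinAt.sub
            ((hdθ τ).sin.hasDerivWithinAt.mul (hdθ τ).cos.hasDerivWithinAt)).const_mul
              (e ^ 2 * k))))
        (fun τ hτ => ((hdθ τ).const_mul _).hasDerivWithinAt)
        (fun τ hτ => by
          refine le_of_eq_of_le ?_ (hbd' τ hτ.2 _ (Real.abs_sin_le_one (θ τ)))
          rw [Real.norm_eq_abs, ← abs_neg]
          congr 1
          have hsc := Real.sin_sq_add_cos_sq (θ τ)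
          linear_combination (e ^ 2 * k * g τ) * hsc)
    have h1 : |0 - F σB| ≤ D * θ σB - D * 0 := le_of_tendsto_of_tendsto
      ((hFlim.sub_const _).abs) ((hlim.const_mul _).const_sub _) (by
        filter_upwards [eventually_le_atBot σB] with σ' hσ' using hvar σ' hσ')
    simp only [hF] at h1
    rw [hθB, hsin, hcos, mul_zero, sub_zero, zero_sub, abs_neg] at h1
    refine le_trans (le_of_eq ?_) (h1.trans hfin)
    congr 1
    ring

end IsPlanarRay

/-! ### From angular momentum to the unperturbed impact parameter -/

/-- Replacing the impact parameter of the ray by that of the unperturbed straight line. -/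
theorem exists_bound_of_impact_parameter {a k c s Φ C₁ : ℝ} (hcs : c ^ 2 + s ^ 2 = 1) (hs : 0 < s)
    (hC₁ : 0 ≤ C₁) :
    ∃ C : ℝ, ∀ e δ P Q : ℝ, 0 < e → e ≤ 1 → 0 < δ → e ≤ 2 * δ → δ * s = e * (s * P - c * Q) →
      |P - (1 + e * a * s + e ^ 2 * k * s ^ 2)| ≤ C₁ * e ^ 3 →
      |Q + (e * a * (1 + c) + e ^ 2 * k * Φ)| ≤ C₁ * e ^ 3 →
      |P - (1 + δ * (a * s + δ * (k * s ^ 2 - a ^ 2 * (1 + c))))| ≤ C * δ ^ 3 ∧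
      |Q + δ * (a * (1 + c) + δ * (k * Φ - a ^ 2 * ((1 + c) ^ 2 / s)))| ≤ C * δ ^ 3 := by
  -- The coefficient in `δ = e + h e² + O(e³)`: at first order `s P - c Q = s + e a (s² + c + c²)`,
  -- and `c² + s² = 1`. Inverted, this is `e = δ - h δ² + O(δ³)`, with `e ≤ 2δ` converting the error
  -- terms.
  set h := a * (1 + c) / s with hh
  set M := |k * s ^ 2 + c * k * Φ / s| + C₁ + C₁ * |c / s| with hM
  have hM0 : 0 ≤ M := by positivity
  set H := |h| + M with hH
  have hH0 : 0 ≤ H := by positivity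
  set S := 8 * M + 12 * |h| * H with hS
  have hS0 : 0 ≤ S := by positivity
  refine ⟨8 * C₁ + (|a * s| + |a * (1 + c)|) * S + (|k * s ^ 2| + |k * Φ|) * (12 * H),
    fun e δ P Q he he1 hδ heδ hrel hP hQ => ?_⟩
  have hs0 := hs.ne'
  have hcube : e ^ 3 ≤ 8 * δ ^ 3 := by
    calc e ^ 3 ≤ (2 * δ) ^ 3 := by gcongr
      _ = 8 * δ ^ 3 := by ring
  have h1 : |δ - e - e ^ 2 * h| ≤ M * e ^ 3 := by
    have hid : δ - e - e ^ 2 * h = e ^ 3 * (k * s ^ 2 + c * k * Φ / s)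
        + e * (P - (1 + e * a * s + e ^ 2 * k * s ^ 2))
        - e * ((c / s) * (Q + (e * a * (1 + c) + e ^ 2 * k * Φ))) := by
      have hδ' : δ = e * (s * P - c * Q) / s := by field_simp; linarith
      have h2 : e * (s * P - c * Q) / s - e - e ^ 2 * h - (e ^ 3 * (k * s ^ 2 + c * k * Φ / s)
        + e * (P - (1 + e * a * s + e ^ 2 * k * s ^ 2))
        - e * ((c / s) * (Q + (e * a * (1 + c) + e ^ 2 * k * Φ)))) =
          e ^ 2 * a / s * (c ^ 2 + s ^ 2 - 1) := by
        rw [hh]; field_simp; ring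
      rw [hcs, sub_self, mul_zero] at h2
      rw [hδ']
      linarith
    rw [hid]
    refine (abs_sub _ _).trans ((add_le_add (abs_add_le _ _) le_rfl).trans ?_)
    rw [abs_mul (e ^ 3), abs_mul e, abs_mul e, abs_mul (c / s), abs_of_pos he,
      abs_of_pos (pow_pos he 3)]
    have e1 : e * |P - (1 + e * a * s + e ^ 2 * k * s ^ 2)| ≤ 1 * (C₁ * e ^ 3) := by gcongr
    have e2 : e * (|c / s| * |Q + (e * a * (1 + c) + e ^ 2 * k * Φ)|) ≤
        1 * (|c / s| * (C₁ * e ^ 3)) := by gcongr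
    calc _ ≤ e ^ 3 * |k * s ^ 2 + c * k * Φ / s| + 1 * (C₁ * e ^ 3)
          + 1 * (|c / s| * (C₁ * e ^ 3)) := by gcongr
      _ = M * e ^ 3 := by rw [hM]; ring
  have h2 : |δ - e| ≤ H * e ^ 2 := by
    have : δ - e = (δ - e - e ^ 2 * h) + e ^ 2 * h := by ring
    rw [this]
    refine (abs_add_le _ _).trans ?_
    rw [abs_mul (e ^ 2), abs_of_nonneg (sq_nonneg e)]
    have : e ^ 3 ≤ e ^ 2 := by nlinarith [sq_nonneg e]
    calc _ ≤ M * e ^ 2 + e ^ 2 * |h| := by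
          gcongr; exact h1.trans (by gcongr)
      _ = H * e ^ 2 := by rw [hH]; ring
  have h3 : |e ^ 2 - δ ^ 2| ≤ 12 * H * δ ^ 3 := by
    rw [show e ^ 2 - δ ^ 2 = -((δ - e) * (δ + e)) by ring, abs_neg, abs_mul,
      abs_of_pos (by linarith : 0 < δ + e)]
    calc _ ≤ (H * e ^ 2) * (δ + 2 * δ) := by gcongr
      _ ≤ (H * (2 * δ) ^ 2) * (δ + 2 * δ) := by gcongr
      _ = _ := by ring
  have h4 : |e - δ + δ ^ 2 * h| ≤ S * δ ^ 3 := by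
    rw [show e - δ + δ ^ 2 * h = -(δ - e - e ^ 2 * h) + -(h * (e ^ 2 - δ ^ 2)) by ring]
    refine (abs_add_le _ _).trans ?_
    rw [abs_neg, abs_neg, abs_mul h]
    calc _ ≤ M * (8 * δ ^ 3) + |h| * (12 * H * δ ^ 3) := by
          gcongr; exact h1.trans (by gcongr)
      _ = _ := by rw [hS]; ring
  have hD3 : 0 ≤ δ ^ 3 := by positivity
  have r1 : 0 ≤ |a * s| * S * δ ^ 3 := by positivity
  have r2 : 0 ≤ |a * (1 + c)| * S * δ ^ 3 := by positivity
  have r3 : 0 ≤ |k * s ^ 2| * (12 * H) * δ ^ 3 := by positivity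
  have r4 : 0 ≤ |k * Φ| * (12 * H) * δ ^ 3 := by positivity
  have r5 : C₁ * e ^ 3 ≤ 8 * C₁ * δ ^ 3 := by
    calc _ ≤ C₁ * (8 * δ ^ 3) := by gcongr
      _ = _ := by ring
  constructor
  -- Replacing `e` by `δ - h δ²` in the linear term gives `-a s h δ² = -a² (1 + c) δ²`; in the
  -- equation for `Q`, likewise, `a (1 + c) h = a² (1 + c)² / s`.
  · have hid : P - (1 + δ * (a * s + δ * (k * s ^ 2 - a ^ 2 * (1 + c)))) =
        (P - (1 + e * a * s + e ^ 2 * k * s ^ 2)) + (a * s) * (e - δ + δ ^ 2 * h)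
          + (k * s ^ 2) * (e ^ 2 - δ ^ 2) := by
      rw [hh]; field_simp; ring
    rw [hid]
    refine (abs_add_three _ _ _).trans ?_
    rw [abs_mul (a * s), abs_mul (k * s ^ 2)]
    have t1 : |a * s| * |e - δ + δ ^ 2 * h| ≤ |a * s| * (S * δ ^ 3) := by gcongr
    have t2 : |k * s ^ 2| * |e ^ 2 - δ ^ 2| ≤ |k * s ^ 2| * (12 * H * δ ^ 3) := by gcongr
    linarith
  · have hid : Q + δ * (a * (1 + c) + δ * (k * Φ - a ^ 2 * ((1 + c) ^ 2 / s))) =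
        (Q + (e * a * (1 + c) + e ^ 2 * k * Φ)) + -((a * (1 + c)) * (e - δ + δ ^ 2 * h))
          + -((k * Φ) * (e ^ 2 - δ ^ 2)) := by
      rw [hh]; field_simp; ring
    rw [hid]
    refine (abs_add_three _ _ _).trans ?_
    rw [abs_neg, abs_neg, abs_mul (a * (1 + c)), abs_mul (k * Φ)]
    have t1 : |a * (1 + c)| * |e - δ + δ ^ 2 * h| ≤ |a * (1 + c)| * (S * δ ^ 3) := by gcongr
    have t2 : |k * Φ| * |e ^ 2 - δ ^ 2| ≤ |k * Φ| * (12 * H * δ ^ 3) := by gcongr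
    linarith

/-! ### The frame of the ray and planarity -/

section Frame

theorem Triple.inner_eq (v w : Triple) : inner ℝ v w = v 0 * w 0 + v 1 * w 1 + v 2 * w 2 := by
  simp [PiLp.inner_apply, Fin.sum_univ_three, mul_comm]

theorem Triple.cross_apply_zero (v w : Triple) : Triple.cross v w 0 = v 1 * w 2 - v 2 * w 1 := by
  simp [Triple.cross, cross_apply]

theorem Triple.cross_apply_one (v w : Triple) : Triple.cross v w 1 = v 2 * w 0 - v 0 * w 2 := by
  simp [Triple.cross, cross_apply]

theorem Triple.cross_apply_two (v w : Triple) : Triple.cross v w 2 = v 0 * w 1 - v 1 * w 0 := by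
  simp [Triple.cross, cross_apply]

theorem Triple.inner_cross_left (v w : Triple) : inner ℝ v (Triple.cross v w) = 0 := by
  rw [Triple.inner_eq, Triple.cross_apply_zero, Triple.cross_apply_one, Triple.cross_apply_two]
  ring

theorem Triple.inner_cross_right (v w : Triple) : inner ℝ w (Triple.cross v w) = 0 := by
  rw [Triple.inner_eq, Triple.cross_apply_zero, Triple.cross_apply_one, Triple.cross_apply_two]
  ring

theorem Triple.norm_cross_sq (v w : Triple) :
    ‖Triple.cross v w‖ ^ 2 = ‖v‖ ^ 2 * ‖w‖ ^ 2 - (inner ℝ v w : ℝ) ^ 2 := by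
  simp only [← real_inner_self_eq_norm_sq, Triple.inner_eq, Triple.cross_apply_zero,
    Triple.cross_apply_one, Triple.cross_apply_two]
  ring

theorem Triple.cross_smul_cross (t : ℝ) (v w : Triple) :
    Triple.cross (t • Triple.cross v w) v = t • ((‖v‖ ^ 2) • w - (inner ℝ v w : ℝ) • v) := by
  ext i
  fin_cases i <;>
  · simp only [← real_inner_self_eq_norm_sq, Triple.inner_eq, Triple.cross_apply_zero,
      Triple.cross_apply_one, Triple.cross_apply_two, PiLp.smul_apply, PiLp.sub_apply, smul_eq_mul,
      Fin.zero_eta, Fin.mk_one, Fin.reduceFinMk]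
    ring

variable {Ne nB : Triple}

theorem inner_sq_add_norm_cross_sq (hNe : ‖Ne‖ = 1) (hnB : ‖nB‖ = 1) :
    (inner ℝ Ne nB : ℝ) ^ 2 + ‖Triple.cross Ne nB‖ ^ 2 = 1 := by
  rw [Triple.norm_cross_sq, hNe, hnB]; ring

theorem Pe_eq (hNe : ‖Ne‖ = 1) :
    Pe Ne nB = ‖Triple.cross Ne nB‖⁻¹ • (nB - (inner ℝ Ne nB : ℝ) • Ne) := by
  rw [Pe, Triple.cross_smul_cross, hNe, one_pow, one_smul]

/-- The orthonormal frame `(Ne, Pe, Ne × nB / |Ne × nB|)`. -/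
theorem exists_frame (hNe : ‖Ne‖ = 1) (hnB : ‖nB‖ = 1) (hne : Triple.cross Ne nB ≠ 0) :
    ∃ b : OrthonormalBasis (Fin 3) ℝ Triple, b 0 = Ne ∧ b 1 = Pe Ne nB ∧
      b 2 = ‖Triple.cross Ne nB‖⁻¹ • Triple.cross Ne nB := by
  set s := ‖Triple.cross Ne nB‖ with hs
  have hs0 : 0 < s := norm_pos_iff.2 hne
  set c : ℝ := inner ℝ Ne nB with hc
  have hcs : c ^ 2 + s ^ 2 = 1 := inner_sq_add_norm_cross_sq hNe hnB
  have hNN : inner ℝ Ne Ne = (1 : ℝ) := by rw [real_inner_self_eq_norm_sq, hNe, one_pow]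
  have hnn : inner ℝ nB nB = (1 : ℝ) := by rw [real_inner_self_eq_norm_sq, hnB, one_pow]
  have hnN : inner ℝ nB Ne = c := real_inner_comm _ _
  have h01 : inner ℝ Ne (Pe Ne nB) = (0 : ℝ) := by
    rw [Pe_eq hNe, inner_smul_right, inner_sub_right, inner_smul_right, hNN]
    simp
  have h11 : inner ℝ (Pe Ne nB) (Pe Ne nB) = (1 : ℝ) := by
    rw [Pe_eq hNe, inner_smul_right, inner_smul_left, inner_sub_right, inner_sub_left,
      inner_sub_left, inner_smul_right, inner_smul_right, inner_smul_left, inner_smul_left, hNN,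
      hnn, hnN, ← hc, ← hs]
    simp only [conj_trivial]
    field_simp
    linarith
  have h02 : inner ℝ Ne (s⁻¹ • Triple.cross Ne nB) = (0 : ℝ) := by
    rw [inner_smul_right, Triple.inner_cross_left, mul_zero]
  have h12 : inner ℝ (Pe Ne nB) (s⁻¹ • Triple.cross Ne nB) = (0 : ℝ) := by
    rw [Pe_eq hNe, inner_smul_right, inner_smul_left, inner_sub_left, inner_smul_left,
      Triple.inner_cross_left, Triple.inner_cross_right]
    simp
  have h22 : ‖s⁻¹ • Triple.cross Ne nB‖ = 1 := by
    rw [norm_smul, norm_inv, Real.norm_of_nonneg hs0.le, ← hs, inv_mul_cancel₀ hs0.ne']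
  have hon : Orthonormal ℝ ![Ne, Pe Ne nB, s⁻¹ • Triple.cross Ne nB] := by
    rw [orthonormal_iff_ite]
    intro i j
    fin_cases i <;> fin_cases j
    · exact hNN.trans (by simp)
    · simpa using h01
    · simpa using h02
    · simpa using (real_inner_comm _ _).trans h01
    · exact h11.trans (by simp)
    · simpa using h12
    · simpa using (real_inner_comm _ _).trans h02
    · simpa using (real_inner_comm _ _).trans h12
    · exact (real_inner_self_eq_norm_sq _).trans (by simp [h22])
  have hcard : Fintype.card (Fin 3) = Module.finrank ℝ Triple := by simp
  let B := basisOfOrthonormalOfCardEqFinrank hon hcard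
  have hB : ⇑B = ![Ne, Pe Ne nB, s⁻¹ • Triple.cross Ne nB] :=
    coe_basisOfOrthonormalOfCardEqFinrank hon hcard
  refine ⟨B.toOrthonormalBasis (by rw [hB]; exact hon), ?_, ?_, ?_⟩ <;> simp [hB]

end Frame

/-- In an orthonormal frame whose first axis is the direction of emission and whose first two span
the point of reception, a light ray stays in the plane of the first two axes, with constant angular
momentum. -/
theorem planar_of_central {σB : ℝ} {X Y Z P Q R w f : ℝ → ℝ}
    (hX : ∀ σ ≤ σB, HasDerivWithinAt X (w σ * P σ) (Set.Iic σB) σ)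
    (hY : ∀ σ ≤ σB, HasDerivWithinAt Y (w σ * Q σ) (Set.Iic σB) σ)
    (hZ : ∀ σ ≤ σB, HasDerivWithinAt Z (w σ * R σ) (Set.Iic σB) σ)
    (hP : ∀ σ ≤ σB, HasDerivWithinAt P (f σ * X σ) (Set.Iic σB) σ)
    (hQ : ∀ σ ≤ σB, HasDerivWithinAt Q (f σ * Y σ) (Set.Iic σB) σ)
    (hR : ∀ σ ≤ σB, HasDerivWithinAt R (f σ * Z σ) (Set.Iic σB) σ)
    (hP1 : Tendsto P atBot (𝓝 1)) (hQ0 : Tendsto Q atBot (𝓝 0)) (hR0 : Tendsto R atBot (𝓝 0))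
    (hZB : Z σB = 0) (hYB : Y σB ≠ 0) (hb : Y σB * P σB - X σB * Q σB ≠ 0) :
    ∀ σ ≤ σB, Y σ * P σ - X σ * Q σ = Y σB * P σB - X σB * Q σB ∧ Z σ = 0 ∧ R σ = 0 := by
  have hconst : ∀ {x y p q : ℝ → ℝ},
      (∀ σ ≤ σB, HasDerivWithinAt x (w σ * p σ) (Set.Iic σB) σ) →
      (∀ σ ≤ σB, HasDerivWithinAt y (w σ * q σ) (Set.Iic σB) σ) →
      (∀ σ ≤ σB, HasDerivWithinAt p (f σ * x σ) (Set.Iic σB) σ) →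
      (∀ σ ≤ σB, HasDerivWithinAt q (f σ * y σ) (Set.Iic σB) σ) →
      ∀ σ ≤ σB, y σ * p σ - x σ * q σ = y σB * p σB - x σB * q σB := by
    intro x y p q hx hy hp hq σ hσ
    refine eq_of_hasDerivWithinAt_zero_Iic (f := fun σ => y σ * p σ - x σ * q σ) (fun τ hτ => ?_) hσ
    refine (((hy τ hτ).mul (hp τ hτ)).sub ((hx τ hτ).mul (hq τ hτ))).congr_deriv ?_
    ring
  have h3 := hconst hX hY hP hQ
  have h1 := hconst hZ hY hR hQ
  have h2 := hconst hZ hX hR hP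
  rw [hZB] at h1 h2
  simp only [zero_mul, sub_zero] at h1 h2
  have hlim := ((hP1.const_mul (Y σB * R σB)).sub (hQ0.const_mul (X σB * R σB))).sub
    (hR0.const_mul (Y σB * P σB - X σB * Q σB))
  -- This is the orthogonality of the angular momentum vector `J` to the momentum, with the
  -- conserved values inserted. In the limit `σ → -∞` it says that `J` has no component along `Ne`,
  -- hence `R σB = 0`.
  have hzero : ∀ σ ≤ σB, Y σB * R σB * P σ - X σB * R σB * Q σ
      - (Y σB * P σB - X σB * Q σB) * R σ = 0 := fun σ hσ => by
    rw [← h1 σ hσ, ← h2 σ hσ, ← h3 σ hσ]; ring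
  have hJ := tendsto_nhds_unique (hlim.congr' (by
    filter_upwards [eventually_le_atBot σB] with σ hσ using hzero σ hσ)) tendsto_const_nhds
  have hRB : R σB = 0 := by
    have : Y σB * R σB = 0 := by linarith
    exact (mul_eq_zero.1 this).resolve_left hYB
  rw [hRB, mul_zero] at h1 h2
  -- `J` is now a nonzero multiple of the third axis, and position and momentum are both orthogonal
  -- to it.
  refine fun σ hσ => ⟨h3 σ hσ, ?_, ?_⟩
  · refine (mul_eq_zero.1 (?_ : (Y σB * P σB - X σB * Q σB) * Z σ = 0)).resolve_left hb
    rw [← h3 σ hσ]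
    linear_combination X σ * h1 σ hσ - Y σ * h2 σ hσ
  · refine (mul_eq_zero.1 (?_ : (Y σB * P σB - X σB * Q σB) * R σ = 0)).resolve_left hb
    rw [← h3 σ hσ]
    linear_combination P σ * h1 σ hσ - Q σ * h2 σ hσ

namespace IsReducedRay

variable {P : Potentials β γ ε} {m E σB : ℝ} {T : ℝ → ℝ} {x p : ℝ → Triple}

theorem continuousOn_position (h : IsReducedRay P m E σB T x p) : ContinuousOn x (Set.Iic σB) :=
  fun σ hσ => (h.position σ hσ).continuousWithinAt

theorem continuousOn_speed (h : IsReducedRay P m E σB T x p) (hm : 0 < m) :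
    ContinuousOn (fun σ => E * P.B (m / ‖x σ‖)) (Set.Iic σB) := fun σ hσ => by
  have hu := h.u_mem hm hσ
  have h1 : ContinuousWithinAt (fun σ => m / ‖x σ‖) (Set.Iic σB) σ :=
    continuousWithinAt_const.div (h.continuousOn_position σ hσ).norm (h.norm_pos hm hσ).ne'
  exact continuousWithinAt_const.mul
    ((P.continuousAt_B hu.1 hu.2).comp_continuousWithinAt (f := fun σ => m / ‖x σ‖) h1)

/-- From `p = N v` and `‖p‖² = N` follows `N ‖v‖² = 1`, so `p = v / ‖v‖²`. The limit thus needs no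
prior knowledge that `r → ∞`. -/
theorem tendsto_momentum (h : IsReducedRay P m E σB T x p) (hm : 0 < m) {v : ℝ → Triple}
    {Ne : Triple} (hNe : ‖Ne‖ = 1) (hv : Tendsto v atBot (𝓝 Ne))
    (hpv : ∀ σ ≤ σB, P.indexSq (m / ‖x σ‖) • v σ = p σ) : Tendsto p atBot (𝓝 Ne) := by
  have hN : ∀ σ ≤ σB, (‖v σ‖ ^ 2)⁻¹ = P.indexSq (m / ‖x σ‖) := fun σ hσ => by
    have hu := h.u_mem hm hσ
    have hpos := P.indexSq_pos hu.1 hu.2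
    have h1 := h.norm_sq σ hσ
    rw [← hpv σ hσ, norm_smul, Real.norm_of_nonneg hpos.le, mul_pow, pow_two, mul_assoc] at h1
    have h2 : P.indexSq (m / ‖x σ‖) * ‖v σ‖ ^ 2 = 1 := by
      have := mul_left_cancel₀ hpos.ne' (h1.trans (mul_one _).symm)
      exact this
    exact inv_eq_of_mul_eq_one_left h2
  have h1 : Tendsto (fun σ => (‖v σ‖ ^ 2)⁻¹ • v σ) atBot (𝓝 ((‖Ne‖ ^ 2)⁻¹ • Ne)) :=
    ((hv.norm.pow 2).inv₀ (by rw [hNe]; norm_num)).smul hv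
  rw [hNe, one_pow, inv_one, one_smul] at h1
  refine h1.congr' ?_
  filter_upwards [eventually_le_atBot σB] with σ hσ
  rw [hN σ hσ, hpv σ hσ]

/-- The distance of closest approach is at least half the angular momentum. -/
theorem half_angularMomentum_le_norm (h : IsReducedRay P m E σB T x p) {b u₁ : ℝ}
    (hb0 : 0 < b) (hub : 0 < m / (b / 2)) (hu₁ : m / (b / 2) < u₁)
    (hN2 : ∀ u, 0 < u → u < u₁ → P.indexSq u ≤ 2)
    (hb : ∀ σ ≤ σB, b ≤ ‖x σ‖ * ‖p σ‖) (hpB : ‖p σB‖ ≤ 2) {σ : ℝ} (hσ : σ ≤ σB) :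
    b / 2 ≤ ‖x σ‖ := by
  -- By continuity the ray would cross `r = b / 2`, where `b ≤ r ‖p‖` requires `‖p‖ ≥ 2` while the
  -- weak-field bound gives `‖p‖² ≤ 2`. No bound on `N` closer to the centre is needed.
  by_contra hcon
  push Not at hcon
  have hB : b / 2 ≤ ‖x σB‖ := by
    have := hb σB le_rfl
    nlinarith [norm_nonneg (x σB)]
  have hcont : ContinuousOn (fun τ => ‖x τ‖) (Set.Icc σ σB) :=
    (h.continuousOn_position.mono (fun _ hτ => hτ.2)).norm
  obtain ⟨τ, hτ, hτe⟩ := intermediate_value_Icc hσ hcont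
    (show b / 2 ∈ Set.Icc ‖x σ‖ ‖x σB‖ from ⟨hcon.le, hB⟩)
  simp only at hτe
  have h1 := hb τ hτ.2
  have h2 := h.norm_sq τ hτ.2
  have h3 := hN2 _ hub hu₁
  rw [← hτe] at h3
  rw [← h2] at h3
  rw [hτe] at h1
  have h4 : 2 ≤ ‖p τ‖ := by nlinarith
  nlinarith

/-- A light ray that comes from infinity and is nearly straight at its end is a planar motion. -/
theorem isPlanarRay (h : IsReducedRay P m E σB T x p) (hm : 0 < m) (hE : 0 < E) {u₁ K : ℝ}
    (hbd : ∀ u, 0 < u → u < u₁ →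
      |deriv P.indexSq u / 2 - ((1 + γ) + 2 * kappa β γ ε * u)| ≤ K * u ^ 2 ∧
      |P.indexSq u - 1| ≤ K * u ∧ |deriv P.indexSq u / 2| ≤ K ∧
      1 / 2 ≤ P.B u ∧ P.indexSq u ≤ 2 ∧ 1 / 2 ≤ P.indexSq u)
    {fr : OrthonormalBasis (Fin 3) ℝ Triple} {rB c s b : ℝ} (hrB : 0 < rB) (hs : 0 < s)
    (hxB : x σB = rB • (c • fr 0 + s • fr 1)) (hlim : Tendsto p atBot (𝓝 (fr 0)))
    (hb : b = rB * (s * inner ℝ (fr 0) (p σB) - c * inner ℝ (fr 1) (p σB))) (hb0 : 0 < b)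
    (hpB : ‖p σB‖ ≤ 2) (hmb : m / (b / 2) < u₁) :
    IsPlanarRay m b σB (1 + γ) (kappa β γ ε) K (fun σ => inner ℝ (fr 0) (x σ))
      (fun σ => inner ℝ (fr 1) (x σ)) (fun σ => inner ℝ (fr 0) (p σ))
      (fun σ => inner ℝ (fr 1) (p σ)) (fun σ => E * P.B (m / ‖x σ‖))
      (fun σ => deriv P.indexSq (m / ‖x σ‖) / 2) (fun σ => ‖x σ‖) ∧
    inner ℝ (fr 2) (p σB) = (0 : ℝ) := by
  have hframe : ∀ i j, inner ℝ (fr i) (fr j) = if i = j then (1 : ℝ) else 0 :=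
    orthonormal_iff_ite.1 fr.orthonormal
  have hxi : ∀ i, ∀ σ ≤ σB, HasDerivWithinAt (fun σ => (inner ℝ (fr i) (x σ) : ℝ))
      (E * P.B (m / ‖x σ‖) * inner ℝ (fr i) (p σ)) (Set.Iic σB) σ := fun i σ hσ => by
    have := (innerSL ℝ (fr i)).hasFDerivAt.comp_hasDerivWithinAt σ (h.position σ hσ)
    simp only [map_smul, smul_eq_mul, innerSL_apply_apply] at this
    exact this
  have hpi : ∀ i, ∀ σ ≤ σB, HasDerivWithinAt (fun σ => (inner ℝ (fr i) (p σ) : ℝ))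
      (-(E * P.B (m / ‖x σ‖) * (m / ‖x σ‖ ^ 3) * (deriv P.indexSq (m / ‖x σ‖) / 2))
        * inner ℝ (fr i) (x σ)) (Set.Iic σB) σ := fun i σ hσ => by
    have := (innerSL ℝ (fr i)).hasFDerivAt.comp_hasDerivWithinAt σ (h.momentum σ hσ)
    simp only [map_smul, smul_eq_mul, innerSL_apply_apply] at this
    exact this
  have hli : ∀ i, Tendsto (fun σ => (inner ℝ (fr i) (p σ) : ℝ)) atBot
      (𝓝 (inner ℝ (fr i) (fr 0))) := fun i => tendsto_const_nhds.inner hlim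
  have hl0 := hli 0
  have hl1 := hli 1
  have hl2 := hli 2
  rw [hframe] at hl0 hl1 hl2
  simp only [if_true, Fin.reduceEq, if_false] at hl0 hl1 hl2
  have hB : ∀ i, (inner ℝ (fr i) (x σB) : ℝ) =
      rB * (c * (if i = 0 then 1 else 0) + s * (if i = 1 then 1 else 0)) := fun i => by
    rw [hxB, inner_smul_right, inner_add_right, inner_smul_right, inner_smul_right, hframe, hframe]
  have hB0 : (inner ℝ (fr 0) (x σB) : ℝ) = rB * c := by rw [hB]; simp
  have hB1 : (inner ℝ (fr 1) (x σB) : ℝ) = rB * s := by rw [hB]; simp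
  have hB2 : (inner ℝ (fr 2) (x σB) : ℝ) = 0 := by rw [hB]; simp
  have hbB : inner ℝ (fr 1) (x σB) * inner ℝ (fr 0) (p σB)
      - inner ℝ (fr 0) (x σB) * inner ℝ (fr 1) (p σB) = b := by
    rw [hB0, hB1, hb]; ring
  have hplane := planar_of_central (hxi 0) (hxi 1) (hxi 2) (hpi 0) (hpi 1) (hpi 2) hl0 hl1 hl2 hB2
    (by rw [hB1]; positivity) (by rw [hbB]; exact hb0.ne')
  rw [hbB] at hplane
  have hsq : ∀ v : Triple, (inner ℝ (fr 0) v : ℝ) ^ 2 + (inner ℝ (fr 1) v : ℝ) ^ 2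
      + (inner ℝ (fr 2) v : ℝ) ^ 2 = ‖v‖ ^ 2 := fun v => by
    rw [← fr.sum_sq_norm_inner_right v, Fin.sum_univ_three]
    simp only [Real.norm_eq_abs, sq_abs]
  have hxsq : ∀ σ ≤ σB, (inner ℝ (fr 0) (x σ) : ℝ) ^ 2 + (inner ℝ (fr 1) (x σ) : ℝ) ^ 2
      = ‖x σ‖ ^ 2 := fun σ hσ => by
    rw [← hsq, (hplane σ hσ).2.1]; ring
  have hpsq : ∀ σ ≤ σB, (inner ℝ (fr 0) (p σ) : ℝ) ^ 2 + (inner ℝ (fr 1) (p σ) : ℝ) ^ 2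
      = ‖p σ‖ ^ 2 := fun σ hσ => by
    rw [← hsq, (hplane σ hσ).2.2]; ring
  -- Lagrange's identity: the discarded square is that of the inner product of position and
  -- momentum.
  have hble : ∀ σ ≤ σB, b ≤ ‖x σ‖ * ‖p σ‖ := fun σ hσ => by
    refine (le_abs_self b).trans (abs_le_of_sq_le_sq ?_ (by positivity))
    rw [mul_pow, ← hxsq σ hσ, ← hpsq σ hσ, ← (hplane σ hσ).1]
    nlinarith [sq_nonneg ((inner ℝ (fr 0) (x σ) : ℝ) * inner ℝ (fr 0) (p σ)
      + inner ℝ (fr 1) (x σ) * inner ℝ (fr 1) (p σ))]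
  have hub : 0 < m / (b / 2) := by positivity
  have hfar : ∀ σ ≤ σB, m / ‖x σ‖ < u₁ := fun σ hσ => by
    have h1 := h.half_angularMomentum_le_norm hb0 hub hmb
      (fun u h0 h1 => (hbd u h0 h1).2.2.2.2.1) hble hpB hσ
    refine lt_of_le_of_lt ?_ hmb
    gcongr
  have hu : ∀ σ ≤ σB, 0 < m / ‖x σ‖ := fun σ hσ => (h.u_mem hm hσ).1
  refine ⟨⟨hm, hb0, fun σ hσ => h.norm_pos hm hσ, hxsq, hxi 0, hxi 1, hpi 0, hpi 1,
    h.continuousOn_speed hm, ⟨E / 2, by positivity, fun σ hσ => ?_⟩, fun σ hσ => (hplane σ hσ).1,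
    fun σ hσ => (hbd _ (hu σ hσ) (hfar σ hσ)).2.2.1,
    fun σ hσ => (hbd _ (hu σ hσ) (hfar σ hσ)).1, hl0, hl1⟩, (hplane σB le_rfl).2.2⟩
  have := (hbd _ (hu σ hσ) (hfar σ hσ)).2.2.2.1
  nlinarith

end IsReducedRay

end

/-! ### Conclusion -/

theorem proposition6 {β γ ε : ℝ} (P : Potentials β γ ε) (Ne nB : Triple)
    (hNe : ‖Ne‖ = 1) (hnB : ‖nB‖ = 1) (hne : Triple.cross Ne nB ≠ 0) :
    ∃ C : ℝ, ∀ rB : ℝ, 0 < rB → ∀ (x0B σB m₀ : ℝ) (Γ : ℝ → ℝ → Event), 0 < m₀ →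
      IsQuasiMinkowskianFromInfinity P Ne (rB • nB) x0B σB m₀ Γ →
      ∀ᶠ m : ℝ in 𝓝[>] 0,
        let c : ℝ := inner ℝ Ne nB
        let s : ℝ := ‖Triple.cross Ne nB‖
        let rc : ℝ := rB * s
        let κ : ℝ := kappa β γ ε
        ‖directionTriple (P.metric m) σB (Γ m) σB -
            (-Ne
              - ((m / rc) * ((1 + γ) * s
                  + (m / rc) * (κ * s ^ 2 - (1 + γ) ^ 2 * (1 + c)))) • Ne
              + ((m / rc) * ((1 + γ) * (1 + c)
                  + (m / rc) * (κ * (Real.pi - Real.arccos c + s * c)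
                    - (1 + γ) ^ 2 * ((1 + c) ^ 2 / s)))) • Pe Ne nB)‖
          ≤ C * (m / rc) ^ 3 := by
  obtain ⟨u₁, K, hu₁, -, hK, hbd⟩ := P.exists_weak_field_bounds
  obtain ⟨fr, hfr0, hfr1, -⟩ := exists_frame hNe hnB hne
  have hcs := inner_sq_add_norm_cross_sq hNe hnB
  have hPe := Pe_eq (nB := nB) hNe
  have hs : 0 < ‖Triple.cross Ne nB‖ := norm_pos_iff.2 hne
  generalize ‖Triple.cross Ne nB‖ = s at *
  generalize (inner ℝ Ne nB : ℝ) = c at *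
  obtain ⟨C, hC⟩ := exists_bound_of_impact_parameter (a := 1 + γ) (k := kappa β γ ε)
    (Φ := Real.pi - Real.arccos c + s * c) (C₁ := 16 * K + 64 * |kappa β γ ε| * K) hcs hs
    (by have := abs_nonneg (kappa β γ ε); positivity)
  -- One `C` for each of the two components, fixed before `rB` and the ray are chosen.
  refine ⟨C + C, fun rB hrB x0B σB m₀ Γ hm₀ hΓ => ?_⟩
  have hs1 : s ≤ 1 := by nlinarith [sq_nonneg c]
  have hc1 : |c| ≤ 1 := by rw [← sq_le_one_iff_abs_le_one]; nlinarith [sq_nonneg s]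
  have hnB' : nB = c • Ne + s • Pe Ne nB := by
    rw [hPe, smul_smul, mul_inv_cancel₀ hs.ne', one_smul]; abel
  have hxB0 : rB • nB ≠ 0 := by
    refine smul_ne_zero hrB.ne' fun h0 => ?_
    rw [h0, norm_zero] at hnB
    norm_num at hnB
  -- Since `m/b ≤ 2 m/rc` below, the three thresholds give respectively `(m/b) K ≤ 1/8`, `m/(b/2) <
  -- u₁` and `m/b ≤ 1`.
  have ht : 0 < min (1 / (16 * K)) (min (u₁ / 4) (1 / 2)) := by
    simp only [lt_min_iff]; exact ⟨by positivity, by positivity, by norm_num⟩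
  filter_upwards [hΓ.eventually_direction_near hm₀ hxB0 hNe (by positivity : 0 < s / 4),
    Ioo_mem_nhdsGT hm₀, Ioo_mem_nhdsGT (mul_pos ht (mul_pos hrB hs))] with m hdir hm hmt
  intro c' s' rc κ
  have hray' := (hΓ.nullGeodesic m hm.1 hm.2).exists_isReducedRay hm.1 (hΓ.exterior m hm.1 hm.2)
  obtain ⟨E, hE0, hray, hvel⟩ := hray'
  obtain ⟨hE, hnear⟩ := hdir E _ hE0 hray
  have hlim := hray.tendsto_momentum hm.1 hNe (hΓ.emission m hm.1 hm.2) hvel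
  set p : ℝ → Triple := fun σ => -directionTriple (P.metric m) σB (Γ m) σ with hp
  have hrc : 0 < rc := mul_pos hrB hs
  have hδ : m / rc < min (1 / (16 * K)) (min (u₁ / 4) (1 / 2)) := by
    rw [div_lt_iff₀ hrc]; exact hmt.2
  simp only [lt_min_iff] at hδ
  obtain ⟨hδ1, hδ2, hδ3⟩ := hδ
  have hδ0 : 0 < m / rc := div_pos hm.1 hrc
  have hin : ∀ i, |(inner ℝ (fr i) (p σB - Ne) : ℝ)| ≤ s / 4 := fun i => by
    have := abs_real_inner_le_norm (fr i) (p σB - Ne)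
    rw [fr.norm_eq_one, one_mul] at this
    exact this.trans hnear.le
  have hin0 : |(inner ℝ (fr 0) (p σB) : ℝ) - 1| ≤ s / 4 := by
    have := hin 0
    rwa [inner_sub_right, hfr0, real_inner_self_eq_norm_sq, hNe, one_pow, ← hfr0] at this
  have hin1 : |(inner ℝ (fr 1) (p σB) : ℝ)| ≤ s / 4 := by
    have := hin 1
    rw [inner_sub_right, ← hfr0, fr.inner_eq_zero (by decide), sub_zero] at this
    exact this
  -- The tolerance `s / 4` on the direction is chosen for this: it yields `b ≥ rc / 2`, so the
  -- angular momentum is positive and comparable to `rc`.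
  have hlow : s / 2 ≤ s * inner ℝ (fr 0) (p σB) - c * inner ℝ (fr 1) (p σB) := by
    have h1 := (abs_le.1 hin0).1
    have h2 : c * inner ℝ (fr 1) (p σB) ≤ 1 * (s / 4) :=
      (le_abs_self _).trans (by rw [abs_mul]; gcongr)
    nlinarith
  set b := rB * (s * inner ℝ (fr 0) (p σB) - c * inner ℝ (fr 1) (p σB)) with hb
  have hbrc : rc / 2 ≤ b := by
    calc rc / 2 = rB * (s / 2) := by simp only [rc, s']; ring
      _ ≤ b := by rw [hb]; gcongr
  have hb0 : 0 < b := lt_of_lt_of_le (by positivity) hbrc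
  have heδ : m / b ≤ 2 * (m / rc) := by
    calc m / b ≤ m / (rc / 2) := by
          have := hm.1
          gcongr
      _ = 2 * (m / rc) := by field_simp
  have hmb : m / (b / 2) < u₁ := by
    have : m / (b / 2) = 2 * (m / b) := by field_simp
    linarith
  have hxB : (Γ m σB).space = rB • (c • fr 0 + s • fr 1) := by
    rw [hΓ.space_end hm.1 hm.2, hfr0, hfr1, ← hnB']
  have hpB : ‖p σB‖ ≤ 2 := by
    have h1 := norm_le_norm_add_norm_sub' (p σB) Ne
    rw [hNe] at h1
    linarith
  obtain ⟨hplanar, hp2⟩ := hray.isPlanarRay hm.1 hE hbd hrB hs hxB (hfr0.symm ▸ hlim)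
    hb hb0 hpB hmb
  have hrB' : ‖(Γ m σB).space‖ = rB := by
    rw [hΓ.space_end hm.1 hm.2, norm_smul, hnB, mul_one, Real.norm_of_nonneg hrB.le]
  have hfro := orthonormal_iff_ite.1 fr.orthonormal
  have hsmall : m / b * K ≤ 1 / 8 := by
    have : m / b ≤ 1 / (8 * K) := by
      calc m / b ≤ 2 * (1 / (16 * K)) := heδ.trans (by gcongr)
        _ = _ := by field_simp; norm_num
    calc m / b * K ≤ 1 / (8 * K) * K := by gcongr
      _ = 1 / 8 := by field_simp
  obtain ⟨hP, hQ⟩ := hplanar.abs_direction_sub_le hcs hs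
    (by
      simp only [hxB, inner_smul_right, inner_add_right, hfro]
      rw [← hxB, hrB']; simp)
    (by
      simp only [hxB, inner_smul_right, inner_add_right, hfro]
      rw [← hxB, hrB']; simp)
    (hin0.trans (by linarith)) hsmall
  obtain ⟨hP', hQ'⟩ := hC (m / b) (m / rc) _ _ (div_pos hm.1 hb0) (by linarith) hδ0 heδ (by
    simp only [rc, s']
    rw [hb]
    have hD : s * inner ℝ (fr 0) (p σB) - c * inner ℝ (fr 1) (p σB) ≠ 0 := by linarith
    generalize s * inner ℝ (fr 0) (p σB) - c * inner ℝ (fr 1) (p σB) = D at hD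
    field_simp) hP hQ
  have hdecomp : directionTriple (P.metric m) σB (Γ m) σB =
      -((inner ℝ (fr 0) (p σB) : ℝ) • Ne + (inner ℝ (fr 1) (p σB) : ℝ) • Pe Ne nB) := by
    have h1 := fr.sum_repr' (p σB)
    rw [Fin.sum_univ_three, hp2, zero_smul, add_zero, hfr0, hfr1] at h1
    rw [hfr0, hfr1, h1, hp, neg_neg]
  rw [hdecomp]
  have hPe1 : ‖Pe Ne nB‖ = 1 := by rw [← hfr1]; exact fr.norm_eq_one 1
  rw [show ∀ (A B D F : ℝ), -(A • Ne + B • Pe Ne nB) - (-Ne - D • Ne + F • Pe Ne nB) =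
    -((A - (1 + D)) • Ne) - (B + F) • Pe Ne nB from fun A B D F => by module]
  refine (norm_sub_le _ _).trans ?_
  rw [norm_neg, norm_smul, norm_smul, hNe, hPe1, mul_one, mul_one]
  exact (add_le_add hP' hQ').trans_eq (by ring)
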